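/- Let $G$ be a group and $S\subseteq G$ a submonoid with $G=S^{-1}S$, i.e. every element of $G$ has the form $s^{-1}t$ with $s,t\in S$. Let $A$ be a unital ring, let $\alpha\colon S\to \mathrm{Endr}(A)$, $s\mapsto\alpha_s$, be a monoid homomorphism into the monoid (under composition) of not necessarily unital ring endomorphisms of $A$, and put $p_s=\alpha_s(1)$. Assume that each $\alpha_s$ is a corner isomorphism, i.e. injective with image $p_sAp_s$. Let $R=S^{\mathrm{op}}*_\alpha A*_\alpha S$ be the fractional skew monoid ring: the unital ring equipped with a unital ring homomorphism $\phi\colon A\to R$ and monoid homomorphisms $S\to R$, $s\mapsto s_+$, and $S^{\mathrm{op}}\to R$, $s\mapsto s_-$ (into the multiplicative monoid of $R$), universal with respect to the relations $$s_+\phi(a)=\phi(\alpha_s(a))s_+,\qquad \phi(a)s_-=s_-\phi(\alpha_s(a)),\qquad s_-s_+=1,\qquad s_+s_-=\phi(p_s)\qquad(a\in A,\ s\in S).$$ The action $\alpha$ is called outer if there are no distinct $s,t\in S$ for which there exist $u\in p_sAp_t$ and $v\in p_tAp_s$ with $uv=p_s$, $vu=p_t$ and $\alpha_s(x)=u\,\alpha_t(x)\,v$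 for all $x\in A$. An idempotent $e$ of a ring is infinite if $e=f+g$ with $f,g$ orthogonal idempotents, $g\neq0$, and $e=xy$, $f=yx$ for some $x\in eTf$, $y\in fTe$, where $T$ is the ring. A purely infinite simple ring is a simple ring in which every nonzero right ideal contains an infinite idempotent. An ultramatricial algebra over a field $k$ is a unital $k$-algebra that is the union of an ascending sequence of unital subalgebras, each isomorphic to a finite product of full matrix algebras over $k$. Suppose that $A$ is either a purely infinite simple ring, or a simple ring that is an ultramatricial algebra over some field. Suppose also that $\alpha$ is outer and that there exists $u\in S$ with $p_u\neq1$. Then $R=S^{\mathrm{op}}*_\alpha A*_\alpha S$ is a purely infinite simple ring. -/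

import Mathlib

/-- The generators of the ring `Sᵒᵖ *_α A *_α S`: a symbol `φ(a)` for each `a ∈ A`, and symbols
`s₊` and `s₋` for each `s ∈ S`. -/
inductive FracSkewGen (A S : Type*) where
  | coeff (a : A)
  | plus (s : S)
  | minus (s : S)

section Construction

variable {A S : Type*} [Ring A] [Monoid S]

/-- The idempotent `p_s = α_s(1)`. Here `A →ₙ+* A` is the monoid, under composition, of the
not necessarily unital ring endomorphisms of `A`. -/
def actionIdem (α : S →* (A →ₙ+* A)) (s : S) : A := α s 1

open FracSkewGen FreeAlgebra in
/-- The defining relations of `Sᵒᵖ *_α A *_α S`. The first seven say that `φ` is a unital ring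
homomorphism, `s ↦ s₊` a monoid homomorphism and `s ↦ s₋` a monoid anti-homomorphism; the last
four are the relations linking these three maps. -/
inductive FracSkewRel (α : S →* (A →ₙ+* A)) :
    FreeAlgebra ℤ (FracSkewGen A S) → FreeAlgebra ℤ (FracSkewGen A S) → Prop
  | coeff_add (a b : A) :
      FracSkewRel α (ι ℤ (coeff (a + b))) (ι ℤ (coeff a) + ι ℤ (coeff b))
  | coeff_mul (a b : A) :
      FracSkewRel α (ι ℤ (coeff (a * b))) (ι ℤ (coeff a) * ι ℤ (coeff b))
  | coeff_one : FracSkewRel α (ι ℤ (coeff 1)) 1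
  | plus_mul (s t : S) :
      FracSkewRel α (ι ℤ (plus (s * t))) (ι ℤ (plus s) * ι ℤ (plus t))
  | plus_one : FracSkewRel α (ι ℤ (plus 1)) 1
  | minus_mul (s t : S) :
      FracSkewRel α (ι ℤ (minus (s * t))) (ι ℤ (minus t) * ι ℤ (minus s))
  | minus_one : FracSkewRel α (ι ℤ (minus 1)) 1
  | plus_coeff (s : S) (a : A) :
      FracSkewRel α (ι ℤ (plus s) * ι ℤ (coeff a)) (ι ℤ (coeff (α s a)) * ι ℤ (plus s))
  | coeff_minus (s : S) (a : A) :
      FracSkewRel α (ι ℤ (coeff a) * ι ℤ (minus s)) (ι ℤ (minus s) * ι ℤ (coeff (α s a)))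
  | minus_plus (s : S) :
      FracSkewRel α (ι ℤ (minus s) * ι ℤ (plus s)) 1
  | plus_minus (s : S) :
      FracSkewRel α (ι ℤ (plus s) * ι ℤ (minus s)) (ι ℤ (coeff (actionIdem α s)))

/-- The fractional skew monoid ring `Sᵒᵖ *_α A *_α S`, given by generators and relations.
Its universal property is `FracSkewMonoidRing.existsUnique_lift` below. -/
def FracSkewMonoidRing (α : S →* (A →ₙ+* A)) : Type _ := RingQuot (FracSkewRel α)

noncomputable instance (α : S →* (A →ₙ+* A)) : Ring (FracSkewMonoidRing α) :=
  inferInstanceAs (Ring (RingQuot (FracSkewRel α)))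

namespace FracSkewMonoidRing

variable (α : S →* (A →ₙ+* A))

/-- The canonical projection from the free ring. -/
noncomputable def mk : FreeAlgebra ℤ (FracSkewGen A S) →+* FracSkewMonoidRing α :=
  RingQuot.mkRingHom (FracSkewRel α)

theorem mk_rel {x y : FreeAlgebra ℤ (FracSkewGen A S)} (h : FracSkewRel α x y) :
    mk α x = mk α y := RingQuot.mkRingHom_rel h

/-- The ring homomorphism `φ : A → Sᵒᵖ *_α A *_α S`. -/
noncomputable def coeffHom : A →+* FracSkewMonoidRing α :=
  RingHom.mk'
    { toFun := fun a => mk α (FreeAlgebra.ι ℤ (FracSkewGen.coeff a))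
      map_one' := by rw [mk_rel α .coeff_one, map_one]
      map_mul' := fun a b => by rw [mk_rel α (.coeff_mul a b), map_mul] }
    (fun a b => by
      change mk α _ = mk α _ + mk α _
      rw [mk_rel α (.coeff_add a b), map_add])

/-- The monoid homomorphism `s ↦ s₊`. -/
noncomputable def plusHom : S →* FracSkewMonoidRing α where
  toFun s := mk α (FreeAlgebra.ι ℤ (FracSkewGen.plus s))
  map_one' := by rw [mk_rel α .plus_one, map_one]
  map_mul' s t := by rw [mk_rel α (.plus_mul s t), map_mul]

/-- The monoid homomorphism `s ↦ s₋` on the opposite monoid. -/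
noncomputable def minusHom : Sᵐᵒᵖ →* FracSkewMonoidRing α where
  toFun s := mk α (FreeAlgebra.ι ℤ (FracSkewGen.minus s.unop))
  map_one' := by rw [MulOpposite.unop_one, mk_rel α .minus_one, map_one]
  map_mul' s t := by rw [MulOpposite.unop_mul, mk_rel α (.minus_mul t.unop s.unop), map_mul]

/-- The four relations that link `φ`, `s ↦ s₊` and `s ↦ s₋`, for maps into an arbitrary ring. -/
def Compatible {B : Type*} [Ring B] (f : A →+* B) (p : S →* B) (m : Sᵐᵒᵖ →* B) : Prop :=
  (∀ s a, p s * f a = f (α s a) * p s) ∧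
  (∀ s a, f a * m (.op s) = m (.op s) * f (α s a)) ∧
  (∀ s, m (.op s) * p s = 1) ∧
  (∀ s, p s * m (.op s) = f (actionIdem α s))

theorem compatible : Compatible α (coeffHom α) (plusHom α) (minusHom α) := by
  refine ⟨fun s a => ?_, fun s a => ?_, fun s => ?_, fun s => ?_⟩
  · change mk α _ * mk α _ = mk α _ * mk α _
    rw [← map_mul, ← map_mul, mk_rel α (.plus_coeff s a)]
  · change mk α _ * mk α _ = mk α _ * mk α _
    rw [← map_mul, ← map_mul]
    exact mk_rel α (.coeff_minus s a)
  · change mk α _ * mk α _ = 1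
    rw [← map_mul, ← map_one (mk α)]
    exact mk_rel α (.minus_plus s)
  · change mk α _ * mk α _ = mk α _
    rw [← map_mul]
    exact mk_rel α (.plus_minus s)

/-- The universal property of `Sᵒᵖ *_α A *_α S`. -/
theorem existsUnique_lift {B : Type*} [Ring B] (f : A →+* B) (p : S →* B) (m : Sᵐᵒᵖ →* B)
    (h : Compatible α f p m) :
    ∃! g : FracSkewMonoidRing α →+* B,
      (∀ a, g (coeffHom α a) = f a) ∧ (∀ s, g (plusHom α s) = p s) ∧
        ∀ s, g (minusHom α s) = m s := by
  obtain ⟨h1, h2, h3, h4⟩ := h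
  let v : FracSkewGen A S → B := fun
    | .coeff a => f a
    | .plus s => p s
    | .minus s => m (.op s)
  let F : FreeAlgebra ℤ (FracSkewGen A S) →+* B := (FreeAlgebra.lift ℤ v).toRingHom
  have hF : ∀ x, F (FreeAlgebra.ι ℤ x) = v x := fun x => FreeAlgebra.lift_ι_apply v x
  have hrel : ∀ ⦃x y⦄, FracSkewRel α x y → F x = F y := by
    intro x y hxy
    cases hxy <;> simp only [map_add, map_mul, map_one, hF, v, MulOpposite.op_mul,
      MulOpposite.op_one, h1, h2, h3, h4]
  refine ⟨RingQuot.lift ⟨F, hrel⟩, ⟨fun a => ?_, fun s => ?_, fun s => ?_⟩, ?_⟩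
  · exact (RingQuot.lift_mkRingHom_apply F hrel _).trans (hF _)
  · exact (RingQuot.lift_mkRingHom_apply F hrel _).trans (hF _)
  · exact (RingQuot.lift_mkRingHom_apply F hrel _).trans (hF _)
  · rintro g ⟨g1, g2, g3⟩
    refine RingQuot.lift_unique F hrel g ?_
    have key : (RingHom.toIntAlgHom (g.comp (mk α))) = RingHom.toIntAlgHom F := by
      refine FreeAlgebra.hom_ext (funext fun x => ?_)
      change g (mk α (FreeAlgebra.ι ℤ x)) = F (FreeAlgebra.ι ℤ x)
      rw [hF]
      cases x with
      | coeff a => exact g1 a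
      | plus s => exact g2 s
      | minus s => exact g3 (.op s)
    exact RingHom.ext fun x => DFunLike.congr_fun key x

end FracSkewMonoidRing

/-- `α` acts by corner isomorphisms: each `α_s` is injective with image `p_s A p_s`. -/
def ActsByCornerIsos (α : S →* (A →ₙ+* A)) : Prop :=
  ∀ s, Function.Injective (α s) ∧
    Set.range (α s) = {a | ∃ b, a = actionIdem α s * b * actionIdem α s}

/-- The pair `(α_s, α_t)` is inner: there are `u ∈ p_s A p_t` and `v ∈ p_t A p_s` with
`uv = p_s`, `vu = p_t` and `α_s(x) = u α_t(x) v` for all `x`. -/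
def IsInnerPair (α : S →* (A →ₙ+* A)) (s t : S) : Prop :=
  ∃ u v : A,
    (∃ a, u = actionIdem α s * a * actionIdem α t) ∧
    (∃ b, v = actionIdem α t * b * actionIdem α s) ∧
    u * v = actionIdem α s ∧ v * u = actionIdem α t ∧ ∀ x, α s x = u * α t x * v

/-- `α` is outer: `(α_s, α_t)` is not inner for any distinct `s, t`. -/
def IsOuterAction (α : S →* (A →ₙ+* A)) : Prop :=
  ∀ s t : S, s ≠ t → ¬ IsInnerPair α s t

end Construction

section PurelyInfinite

variable {R : Type*} [Ring R]

/-- Equivalence `e ~ f` of idempotents: `e = xy` and `f = yx` with `x ∈ eRf`, `y ∈ fRe`. -/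
def IdemEquiv (e f : R) : Prop :=
  ∃ x y : R, e * x * f = x ∧ f * y * e = y ∧ x * y = e ∧ y * x = f

/-- An infinite idempotent: `e = f + g` with `f, g` orthogonal idempotents, `e ~ f`, `g ≠ 0`. -/
def IsInfiniteIdem (e : R) : Prop :=
  IsIdempotentElem e ∧ ∃ f g : R, IsIdempotentElem f ∧ IsIdempotentElem g ∧
    f * g = 0 ∧ g * f = 0 ∧ e = f + g ∧ g ≠ 0 ∧ IdemEquiv e f

/-- A purely infinite simple ring: a simple ring in which every nonzero right ideal (that is,
every nonzero `Rᵐᵒᵖ`-submodule of `R`) contains an infinite idempotent. -/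
def IsPurelyInfiniteSimple (R : Type*) [Ring R] : Prop :=
  IsSimpleRing R ∧ ∀ I : Submodule Rᵐᵒᵖ R, I ≠ ⊥ → ∃ e ∈ I, IsInfiniteIdem e

end PurelyInfinite

/-- A matricial `k`-algebra: a finite product of full matrix algebras over `k`. -/
def IsMatricial (k B : Type*) [Field k] [Ring B] [Algebra k B] : Prop :=
  ∃ (r : ℕ) (n : Fin r → ℕ), (∀ i, 0 < n i) ∧
    Nonempty (B ≃ₐ[k] ((i : Fin r) → Matrix (Fin (n i)) (Fin (n i)) k))

/-- An ultramatricial `k`-algebra: the union of an ascending sequence of (unital) matricial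
subalgebras. -/
def IsUltramatricial (k A : Type*) [Field k] [Ring A] [Algebra k A] : Prop :=
  ∃ B : ℕ → Subalgebra k A, Monotone B ∧ (∀ n, IsMatricial k (B n)) ∧ ∀ a, ∃ n, a ∈ B n

/-!
Write `R = Sᵒᵖ *_α A *_α S` and regard `A` as a subring of `R` via `φ`, which is injective because
`R` acts on a space of germs of functions `G → A` (`FracSkewMonoidRing.coeffHom_injective`).
The ring `R` is graded by `G`, with `s₋ φ(a) t₊` homogeneous of degree `s⁻¹ t`; in degree `1` this
gives just `A`, because the `α_s` are corner isomorphisms.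

Everything follows from the fact that every nonzero `x ∈ R` can be compressed to an infinite
idempotent `y x z = φ(e)` with `0 ≠ e ∈ A`. Indeed, a two-sided ideal containing `x` then contains
`1` since `A` is simple, and a right ideal containing `x` contains the idempotent `x z φ(e) y`,
which is equivalent to `φ(e)` and therefore infinite
(`isPurelyInfiniteSimple_of_forall_exists`).

For elements of `A` this compression depends on the kind of ring. If `A` is purely infinite
simple, it takes place inside `A`. If `A` is simple ultramatricial and `p_u ≠ 1`, then
`1 = ∑ x_j (1 - p_u) y_j` with `K` terms for some `K`. Applying `α_u` repeatedly, one sees that the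
rank of `p_{uⁿ}` in every simple factor of a large matricial subalgebra is at most
`((K - 1) / K)ⁿ` times the rank of `1`. Hence `p_{uⁿ} = b a c` for any given `a ≠ 0` and large `n`
(`IsUltramatricial.exists_iterate_eq_mul_mul`), so that `a` is compressed to
`(uⁿ)₋ p_{uⁿ} (uⁿ)₊ = 1`, which is infinite in `R` because `u₋ u₊ = 1` and `u₊ u₋ = p_u ≠ 1`.

For general `x ≠ 0`, choose `w = y x z ≠ 0` with as few homogeneous components as possible. It may
be assumed that its component of degree `1` is an idempotent `e = f + g ∈ A` as above, with `f, g`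
orthogonal and nonzero, and that `w = e w e`. If `b, c ∈ e A e` and `b c = 0`, then `b w c` has no
component in degree `1`, so it vanishes by minimality. Hence any component `s₋ a t₊` of `w` with
`s ≠ t` satisfies `α_s(b) a α_t(c) = 0` for all such `b, c`. With complementary idempotents of
`e A e` in the roles of `b` and `c`, this says that `a` intertwines `α_s` and `α_t` on the
idempotents of `e A e`, which generate `e A e`; by simplicity `a` is invertible on the corner and
extends to an equivalence of `α_s` and `α_t`, contrary to outerness
(`isInnerPair_of_forall_mul_eq_zero`). So `w` is the infinite idempotent `e`
(`FracSkewMonoidRing.exists_mul_mul_eq_coeffHom`).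
-/

/-! ### Idempotents and simple rings -/

section Idempotents

variable {R : Type*} [Ring R]

/-- If `e` is an infinite idempotent and `e = y x z`, then `x z e y` is an idempotent equivalent
to `e`; being infinite is transported along this equivalence. -/
theorem IsInfiniteIdem.mul_transfer {e x y z : R} (he : IsInfiniteIdem e) (h : y * x * z = e) :
    IsInfiniteIdem (x * (z * e * y)) := by
  obtain ⟨hee, f, g, hf, hg, hfg, hgf, hsum, hg0, P, Q, hP, hQ, hPQ, hQP⟩ := he
  unfold IsIdempotentElem at *
  have hef : e * f = f := by rw [hsum, add_mul, hf, hgf, add_zero]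
  have heg : e * g = g := by rw [hsum, add_mul, hg, hfg, zero_add]
  have hfe : f * e = f := by rw [hsum, mul_add, hf, hfg, add_zero]
  have hge : g * e = g := by rw [hsum, mul_add, hg, hgf, zero_add]
  obtain ⟨X, hX⟩ : ∃ X, X = x * (z * e) := ⟨_, rfl⟩
  obtain ⟨Y, hY⟩ : ∃ Y, Y = e * y := ⟨_, rfl⟩
  have hYX : Y * X = e := by
    calc Y * X = e * (y * x * z) * e := by rw [hX, hY]; noncomm_ring
      _ = e := by rw [h, hee, hee]
  have hXe : X * e = X := by rw [hX, mul_assoc, mul_assoc, hee]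
  have heY : e * Y = Y := by rw [hY, ← mul_assoc, hee]
  have hXY : x * (z * e * y) = X * e * Y := by
    rw [hXe, hX, hY, mul_assoc x, mul_assoc z e (e * y), ← mul_assoc e e y, hee, mul_assoc z e y]
  -- `c ↦ X c Y` is multiplicative on `e R e`
  have key : ∀ c d : R, (X * c * Y) * (X * d * Y) = X * (c * e * d) * Y := by
    intro c d
    calc (X * c * Y) * (X * d * Y) = X * (c * (Y * X) * d) * Y := by noncomm_ring
      _ = _ := by rw [hYX]
  have hPf : P * f = P := by rw [← hP, mul_assoc, hf]
  have heP : e * P = P := by rw [← hP, mul_assoc e P, ← mul_assoc e, hee]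
  have hQe : Q * e = Q := by rw [← hQ, mul_assoc, hee]
  have hfQ : f * Q = Q := by rw [← hQ, mul_assoc f Q, ← mul_assoc f, hf]
  have hPe : P * e = P := by rw [← hPf, mul_assoc, hfe]
  have heQ : e * Q = Q := by rw [← hfQ, ← mul_assoc, hef]
  rw [hXY]
  refine ⟨by rw [IsIdempotentElem, key, hee, hee], X * f * Y, X * g * Y, ?_, ?_, ?_, ?_, ?_, ?_,
    X * P * Y, X * Q * Y, ?_, ?_, ?_, ?_⟩
  · rw [IsIdempotentElem, key, hfe, hf]
  · rw [IsIdempotentElem, key, hge, hg]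
  · rw [key, hfe, hfg, mul_zero, zero_mul]
  · rw [key, hge, hgf, mul_zero, zero_mul]
  · rw [← add_mul, ← mul_add, hsum]
  · intro h0
    apply hg0
    calc g = (Y * X) * g * (Y * X) := by rw [hYX, heg, hge]
      _ = Y * (X * g * Y) * X := by noncomm_ring
      _ = 0 := by rw [h0, mul_zero, zero_mul]
  · rw [key, key, hee, heP, hPe, hPf]
  · rw [key, key, hfe, hfQ, hQe, hQe]
  · rw [key, hPe, hPQ]
  · rw [key, hQe, hQP]

theorem IsInfiniteIdem.map {T : Type*} [Ring T] {e : R} (he : IsInfiniteIdem e) (φ : R →+* T)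
    (hφ : Function.Injective φ) : IsInfiniteIdem (φ e) := by
  obtain ⟨hee, f, g, hf, hg, hfg, hgf, hsum, hg0, P, Q, hP, hQ, hPQ, hQP⟩ := he
  refine ⟨hee.map φ, φ f, φ g, hf.map φ, hg.map φ, ?_, ?_, ?_, ?_, φ P, φ Q, ?_, ?_, ?_, ?_⟩
  · rw [← map_mul, hfg, map_zero]
  · rw [← map_mul, hgf, map_zero]
  · rw [hsum, map_add]
  · rwa [map_ne_zero_iff φ hφ]
  · rw [← map_mul, ← map_mul, hP]
  · rw [← map_mul, ← map_mul, hQ]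
  · rw [← map_mul, hPQ]
  · rw [← map_mul, hQP]

/-- A ring is purely infinite simple as soon as every nonzero element can be multiplied, on the
left and on the right, into an infinite idempotent, and these idempotents generate the unit
ideal. -/
theorem isPurelyInfiniteSimple_of_forall_exists [Nontrivial R]
    (h : ∀ x : R, x ≠ 0 → ∃ y z : R, IsInfiniteIdem (y * x * z) ∧
      ∀ I : TwoSidedIdeal R, y * x * z ∈ I → 1 ∈ I) : IsPurelyInfiniteSimple R := by
  refine ⟨⟨⟨fun I => ?_⟩⟩, fun I hI => ?_⟩
  · by_cases hI : I = ⊥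
    · exact Or.inl hI
    right
    obtain ⟨x, hxI, hx0⟩ : ∃ x ∈ I, x ≠ 0 := by
      by_contra! hcon
      exact hI (le_bot_iff.mp fun x hx => by
        rw [TwoSidedIdeal.mem_bot]; exact hcon x hx)
    obtain ⟨y, z, -, hyz⟩ := h x hx0
    have h1 := hyz I (I.mul_mem_right _ _ (I.mul_mem_left _ _ hxI))
    exact top_le_iff.mp fun r _ => by simpa using I.mul_mem_left r 1 h1
  · obtain ⟨x, hxI, hx0⟩ := Submodule.exists_mem_ne_zero_of_ne_bot hI
    obtain ⟨y, z, hyz, -⟩ := h x hx0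
    exact ⟨_, by simpa using I.smul_mem (MulOpposite.op (z * (y * x * z) * y)) hxI,
      hyz.mul_transfer rfl⟩

/-- In a simple ring, `1` is a finite sum of elements `y x z` for every `x ≠ 0`. -/
theorem IsSimpleRing.exists_sum_mul_mul_eq_one [IsSimpleRing R] {x : R} (hx : x ≠ 0) :
    ∃ (n : ℕ) (y z : Fin n → R), ∑ i, y i * x * z i = 1 := by
  have h1 : (1 : R) ∈ TwoSidedIdeal.span {x} := by
    have : TwoSidedIdeal.span {x} = ⊤ := by
      refine (eq_bot_or_eq_top _).resolve_left fun hbot => hx ?_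
      have : x ∈ TwoSidedIdeal.span {x} := TwoSidedIdeal.subset_span rfl
      rwa [hbot, TwoSidedIdeal.mem_bot] at this
    rw [this]; trivial
  generalize (1 : R) = r at h1 ⊢
  rw [TwoSidedIdeal.mem_span_iff_mem_addSubgroup_closure] at h1
  induction h1 using AddSubgroup.closure_induction with
  | mem a ha =>
    obtain ⟨_, ⟨y, -, _, rfl, rfl⟩, z, -, rfl⟩ := ha
    exact ⟨1, fun _ => y, fun _ => z, by simp⟩
  | zero => exact ⟨0, Fin.elim0, Fin.elim0, by simp⟩
  | add a b _ _ iha ihb =>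
    obtain ⟨n, y, z, rfl⟩ := iha
    obtain ⟨m, y', z', rfl⟩ := ihb
    exact ⟨n + m, Fin.append y y', Fin.append z z', by simp [Fin.sum_univ_add]⟩
  | neg a _ iha =>
    obtain ⟨n, y, z, rfl⟩ := iha
    exact ⟨n, -y, z, by simp⟩

end Idempotents

/-! ### Inner pairs from intertwiners -/

section Inner

variable {A S : Type*} [Ring A] [Monoid S] {α : S →* (A →ₙ+* A)}

/-- In a simple ring with orthogonal nonzero idempotents `f, g`, a non-unital subring that
contains all idempotents below `e = f + g` contains `e A e`: it contains
`f A g` and `g A f` since `f + f x g` is idempotent, and `f A f = f A g A f` by simplicity. -/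
theorem NonUnitalSubring.corner_mem_of_idempotents_mem [IsSimpleRing A] (C : NonUnitalSubring A)
    {f g : A} (hf : IsIdempotentElem f) (hg : IsIdempotentElem g) (hfg : f * g = 0)
    (hgf : g * f = 0) (hf0 : f ≠ 0) (hg0 : g ≠ 0)
    (hC : ∀ c, IsIdempotentElem c → (f + g) * c * (f + g) = c → c ∈ C) (x : A) :
    (f + g) * x * (f + g) ∈ C := by
  have offdiag : ∀ f g : A, IsIdempotentElem f → IsIdempotentElem g → f * g = 0 → g * f = 0 →
      (∀ c, IsIdempotentElem c → (f + g) * c * (f + g) = c → c ∈ C) →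
      ∀ x, f * x * g ∈ C := by
    intro f g hf hg hfg hgf hC x
    unfold IsIdempotentElem at hf hg
    have hff : f ∈ C := hC f hf (by
      simp only [add_mul, mul_add, hf, hgf, hfg, add_zero])
    have h1 : f * (f * x * g) = f * x * g := by rw [← mul_assoc, ← mul_assoc, hf]
    have h2 : f * x * g * g = f * x * g := by rw [mul_assoc, hg]
    have h3 : f * x * g * f = 0 := by rw [mul_assoc, hgf, mul_zero]
    have h4 : g * (f * x * g) = 0 := by rw [← mul_assoc, ← mul_assoc, hgf, zero_mul, zero_mul]
    have h5 : f * x * g * (f * x * g) = 0 := by rw [mul_assoc _ g, h4, mul_zero]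
    have h6 : f + f * x * g ∈ C := hC _
      (by rw [IsIdempotentElem, add_mul, mul_add, mul_add, hf, h1, h3, h5]; abel)
      (by simp only [add_mul, mul_add, hf, hgf, h1, h2, h3, h4, hfg, zero_mul]; abel)
    simpa using C.sub_mem h6 hff
  have diag : ∀ f g : A, IsIdempotentElem f → IsIdempotentElem g → f * g = 0 → g * f = 0 → g ≠ 0 →
      (∀ c, IsIdempotentElem c → (f + g) * c * (f + g) = c → c ∈ C) →
      ∀ x, f * x * f ∈ C := by
    intro f g hf hg hfg hgf hg0 hC x
    obtain ⟨n, y, z, hyz⟩ := IsSimpleRing.exists_sum_mul_mul_eq_one hg0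
    have h : f * x * f = ∑ i, (f * (x * y i) * g) * (g * z i * f) := by
      calc f * x * f = f * x * (∑ i, y i * g * z i) * f := by rw [hyz, mul_one]
        _ = ∑ i, f * x * (y i * (g * g) * z i) * f := by
          rw [hg.eq, Finset.mul_sum, Finset.sum_mul]
        _ = _ := Finset.sum_congr rfl fun i _ => by noncomm_ring
    rw [h]
    exact sum_mem fun i _ => C.mul_mem (offdiag f g hf hg hfg hgf hC _)
      (offdiag g f hg hf hgf hfg (by rwa [add_comm]) _)
  have h : (f + g) * x * (f + g) = (f * x * f + f * x * g) + (g * x * f + g * x * g) := by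
    noncomm_ring
  have hC' : ∀ c, IsIdempotentElem c → (g + f) * c * (g + f) = c → c ∈ C := by
    rwa [add_comm]
  rw [h]
  exact C.add_mem (C.add_mem (diag f g hf hg hfg hgf hg0 hC x) (offdiag f g hf hg hfg hgf hC x))
    (C.add_mem (offdiag g f hg hf hgf hfg hC' x) (diag g f hg hf hgf hfg hf0 hC' x))

/-- If `a` intertwines `α_s` and `α_t` on a corner `e A e`, and has an inverse `v` relative to
`α_s(e)` and `α_t(e)`, then summing translates of `a` over a decomposition `1 = ∑ y_i e z_i`
gives elements showing that `(α_s, α_t)` is inner. -/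
theorem isInnerPair_of_corner [IsSimpleRing A] {s t : S} {e a v : A} (he : IsIdempotentElem e)
    (he0 : e ≠ 0) (hav : a * v = α s e) (hva : v * a = α t e)
    (ha : ∀ x, α s (e * x * e) * a = a * α t (e * x * e)) : IsInnerPair α s t := by
  obtain ⟨n, y, z, hyz⟩ := IsSimpleRing.exists_sum_mul_mul_eq_one he0
  have hs : ∀ x, a * α t (e * x * e) * v = α s (e * x * e) := by
    intro x
    rw [← ha, mul_assoc, hav, ← map_mul, mul_assoc, he.eq]
  have ht : ∀ x, v * α s (e * x * e) * a = α t (e * x * e) := by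
    intro x
    rw [mul_assoc, ha, ← mul_assoc, hva, ← map_mul, ← mul_assoc, ← mul_assoc, he.eq]
  have hea : α s e * a = a * α t e := by simpa [he.eq] using ha 1
  have h1s : ∀ x, α s 1 * α s x = α s x := fun x => by rw [← map_mul, one_mul]
  have hs1 : ∀ x, α s x * α s 1 = α s x := fun x => by rw [← map_mul, mul_one]
  have h1t : ∀ x, α t 1 * α t x = α t x := fun x => by rw [← map_mul, one_mul]
  have ht1 : ∀ x, α t x * α t 1 = α t x := fun x => by rw [← map_mul, mul_one]
  have hUxV : ∀ x, (∑ i, α s (y i * e) * a * α t (e * z i)) * α t x *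
      (∑ j, α t (y j * e) * v * α s (e * z j)) = α s x := by
    intro x
    rw [Finset.sum_mul, Finset.sum_mul_sum]
    calc _ = ∑ i, ∑ j, α s (y i * e) * (a * α t (e * (z i * x * y j) * e) * v) * α s (e * z j) := by
          refine Finset.sum_congr rfl fun i _ => Finset.sum_congr rfl fun j _ => ?_
          simp only [map_mul]; noncomm_ring
      _ = ∑ i, ∑ j, α s ((y i * (e * e) * z i) * x * (y j * (e * e) * z j)) := by
          refine Finset.sum_congr rfl fun i _ => Finset.sum_congr rfl fun j _ => ?_
          rw [hs]; simp only [map_mul]; noncomm_ring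
      _ = α s ((∑ i, y i * e * z i) * x * (∑ j, y j * e * z j)) := by
          rw [Finset.sum_mul, Finset.sum_mul_sum, map_sum, he.eq]
          exact Finset.sum_congr rfl fun i _ => (map_sum _ _ _).symm
      _ = α s x := by rw [hyz, one_mul, mul_one]
  have hVxU : ∀ x, (∑ j, α t (y j * e) * v * α s (e * z j)) * α s x *
      (∑ i, α s (y i * e) * a * α t (e * z i)) = α t x := by
    intro x
    rw [Finset.sum_mul, Finset.sum_mul_sum]
    calc _ = ∑ i, ∑ j, α t (y i * e) * (v * α s (e * (z i * x * y j) * e) * a) * α t (e * z j) := by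
          refine Finset.sum_congr rfl fun i _ => Finset.sum_congr rfl fun j _ => ?_
          simp only [map_mul]; noncomm_ring
      _ = ∑ i, ∑ j, α t ((y i * (e * e) * z i) * x * (y j * (e * e) * z j)) := by
          refine Finset.sum_congr rfl fun i _ => Finset.sum_congr rfl fun j _ => ?_
          rw [ht]; simp only [map_mul]; noncomm_ring
      _ = α t ((∑ i, y i * e * z i) * x * (∑ j, y j * e * z j)) := by
          rw [Finset.sum_mul, Finset.sum_mul_sum, map_sum, he.eq]
          exact Finset.sum_congr rfl fun i _ => (map_sum _ _ _).symm
      _ = α t x := by rw [hyz, one_mul, mul_one]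
  have hU1 : (∑ i, α s (y i * e) * a * α t (e * z i)) * α t 1 =
      ∑ i, α s (y i * e) * a * α t (e * z i) := by
    rw [Finset.sum_mul]
    exact Finset.sum_congr rfl fun i _ => by rw [mul_assoc, ht1]
  have hV1 : (∑ j, α t (y j * e) * v * α s (e * z j)) * α s 1 =
      ∑ j, α t (y j * e) * v * α s (e * z j) := by
    rw [Finset.sum_mul]
    exact Finset.sum_congr rfl fun i _ => by rw [mul_assoc, hs1]
  refine ⟨∑ i, α s (y i * e) * a * α t (e * z i), ∑ j, α t (y j * e) * v * α s (e * z j),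
    ⟨∑ i, α s (y i * e) * a * α t (e * z i), ?_⟩,
    ⟨∑ j, α t (y j * e) * v * α s (e * z j), ?_⟩, ?_, ?_, fun x => (hUxV x).symm⟩
  · rw [actionIdem, actionIdem, mul_assoc, hU1, Finset.mul_sum]
    exact Finset.sum_congr rfl fun i _ => by rw [← mul_assoc, ← mul_assoc, h1s]
  · rw [actionIdem, actionIdem, mul_assoc, hV1, Finset.mul_sum]
    exact Finset.sum_congr rfl fun i _ => by rw [← mul_assoc, ← mul_assoc, h1t]
  · rw [actionIdem, ← hUxV 1, hU1]
  · rw [actionIdem, ← hVxU 1, hV1]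

/-- Over a simple ring, a nonzero intertwiner on a corner is invertible between `α_t(e)` and
`α_s(e)`: the elements `x ∈ e A e` with `α_s(x) ∈ a A` form a nonzero ideal of `e A e`. -/
theorem exists_right_inv_of_intertwines [IsSimpleRing A] {s t : S}
    (hs : {x | ∃ b, x = actionIdem α s * b * actionIdem α s} ⊆ Set.range (α s))
    {e a : A} (he : IsIdempotentElem e) (he0 : α s e ≠ 0) (ha0 : a ≠ 0) (hea : α s e * a = a)
    (ha : ∀ x, α s (e * x * e) * a = a * α t (e * x * e)) :
    ∃ v, a * v = α s e ∧ α t e * v = v := by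
  have hse : α s e * α s e = α s e := by rw [← map_mul, he.eq]
  obtain ⟨b, hb⟩ : ∃ b, a * b * α s e ≠ 0 := by
    by_contra! hcon
    obtain ⟨n, y, z, hyz⟩ := IsSimpleRing.exists_sum_mul_mul_eq_one he0
    apply ha0
    rw [← mul_one a, ← hyz, Finset.mul_sum]
    exact Finset.sum_eq_zero fun i _ => by rw [← mul_assoc, ← mul_assoc, hcon, zero_mul]
  obtain ⟨x', hx'⟩ : a * b * α s e ∈ Set.range (α s) := hs ⟨a * b * α s e, by
    have h1 : α s 1 * a = a := by rw [← hea, ← mul_assoc, ← map_mul, one_mul]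
    rw [actionIdem, mul_assoc _ _ (α s 1), mul_assoc (a * b), ← map_mul, mul_one, ← mul_assoc,
      ← mul_assoc, h1]⟩
  have hx : α s (e * x' * e) = a * b * α s e := by
    rw [map_mul, map_mul, hx', mul_assoc, mul_assoc, hse, mul_assoc, ← mul_assoc, hea]
  have hx0 : e * x' * e ≠ 0 := fun h => hb (by rw [← hx, h, map_zero])
  obtain ⟨n, y, z, hyz⟩ := IsSimpleRing.exists_sum_mul_mul_eq_one hx0
  refine ⟨α t e * (∑ i, α t (e * y i * e) * b * α s (e * z i * e)) * α s e, ?_, ?_⟩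
  · have hae : a * α t e = a := by
      have := ha 1
      rw [mul_one, he.eq, hea] at this
      exact this.symm
    calc a * (α t e * (∑ i, α t (e * y i * e) * b * α s (e * z i * e)) * α s e)
        = ∑ i, a * α t (e * y i * e) * b * (α s (e * z i * (e * e))) := by
          rw [← mul_assoc, ← mul_assoc, hae, Finset.mul_sum, Finset.sum_mul]
          refine Finset.sum_congr rfl fun i _ => ?_
          simp only [map_mul]; noncomm_ring
      _ = ∑ i, α s (e * y i * e) * (a * b * α s e) * α s (e * z i * e) := by
          refine Finset.sum_congr rfl fun i _ => ?_
          rw [← ha, he.eq, ← mul_assoc (α s _) (a * b), mul_assoc _ (α s e), ← map_mul, ← mul_assoc e,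
            ← mul_assoc e, he.eq, mul_assoc _ a b]
      _ = α s (e * (∑ i, y i * (e * x' * e) * z i) * e) := by
          rw [Finset.mul_sum, Finset.sum_mul, map_sum]
          refine Finset.sum_congr rfl fun i _ => ?_
          rw [← hx, ← map_mul, ← map_mul]
          congr 1
          calc e * y i * e * (e * x' * e) * (e * z i * e)
              = e * (y i * ((e * e) * x' * (e * e)) * z i) * e := by noncomm_ring
            _ = _ := by rw [he.eq]
      _ = α s e := by rw [hyz, mul_one, he.eq]
  · rw [← mul_assoc, ← mul_assoc, ← map_mul, he.eq]

/-- The criterion by which outerness is contradicted: an element `a ≠ 0` such that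
`α_s(b) a α_t(c) = 0` for all `b, c ∈ e A e` with `b c = 0`, where `e` is a sum of two nonzero
orthogonal idempotents, makes the pair `(α_s, α_t)` inner. Taking for `b, c` complementary
idempotents of `e A e`, one sees that `a` intertwines the idempotents, hence all of `e A e`. -/
theorem isInnerPair_of_forall_mul_eq_zero [IsSimpleRing A] (hα : ActsByCornerIsos α) {s t : S}
    {f g a : A} (hf : IsIdempotentElem f) (hg : IsIdempotentElem g) (hfg : f * g = 0)
    (hgf : g * f = 0) (hf0 : f ≠ 0) (hg0 : g ≠ 0) (ha0 : a ≠ 0)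
    (ha : α s (f + g) * a * α t (f + g) = a)
    (h : ∀ b c, (f + g) * b * (f + g) = b → (f + g) * c * (f + g) = c → b * c = 0 →
      α s b * a * α t c = 0) : IsInnerPair α s t := by
  have he : IsIdempotentElem (f + g) := by
    rw [IsIdempotentElem, add_mul, mul_add, mul_add, hf.eq, hg.eq, hfg, hgf, add_zero, zero_add]
  have hf_low : (f + g) * f = f := by rw [add_mul, hf.eq, hgf, add_zero]
  obtain ⟨e, hedef⟩ : ∃ e, e = f + g := ⟨_, rfl⟩
  have he0 : e ≠ 0 := fun h0 => hf0 (by rw [← hf_low, ← hedef, h0, zero_mul])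
  let C : NonUnitalSubring A :=
    { carrier := {x | α s x * a = a * α t x}
      zero_mem' := by simp
      add_mem' := fun {x y} hx hy => by
        simp only [Set.mem_ofPred_eq, map_add, add_mul, mul_add] at *; rw [hx, hy]
      neg_mem' := fun {x} hx => by
        simp only [Set.mem_ofPred_eq, map_neg, neg_mul, mul_neg] at *; rw [hx]
      mul_mem' := fun {x y} hx hy => by
        simp only [Set.mem_ofPred_eq, map_mul] at *
        rw [mul_assoc, hy, ← mul_assoc, hx, mul_assoc] }
  have hea : α s e * a = a := by
    rw [← ha, ← hedef, ← mul_assoc, ← mul_assoc, ← map_mul, hedef, he.eq]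
  have hae : a * α t e = a := by
    rw [← ha, ← hedef, mul_assoc, ← map_mul, hedef, he.eq]
  have hC : ∀ c, IsIdempotentElem c → (f + g) * c * (f + g) = c → c ∈ C := by
    intro c hc hec
    rw [← hedef] at hec he
    have hec' : e * c = c := by rw [← hec, ← mul_assoc, ← mul_assoc, he.eq]
    have hce : c * e = c := by rw [← hec, mul_assoc, he.eq]
    have hd : e * (e - c) * e = e - c := by
      rw [mul_sub, sub_mul, he.eq, he.eq, hec', hce]
    rw [← hedef] at h
    have h1 := h c (e - c) hec hd (by rw [mul_sub, hce, hc.eq, sub_self])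
    have h2 := h (e - c) c hd hec (by rw [sub_mul, hec', hc.eq, sub_self])
    rw [map_sub, mul_sub, mul_assoc, hae, sub_eq_zero] at h1
    rw [map_sub, sub_mul, sub_mul, hea, sub_eq_zero] at h2
    exact h1.trans h2.symm
  have hint : ∀ x, α s (e * x * e) * a = a * α t (e * x * e) := by
    subst hedef
    exact C.corner_mem_of_idempotents_mem hf hg hfg hgf hf0 hg0 hC
  rw [← hedef] at he
  have hse0 : α s e ≠ 0 := by rwa [Ne, map_eq_zero_iff _ (hα s).1]
  obtain ⟨v, hav, hv⟩ :=
    exists_right_inv_of_intertwines (hα s).2.ge he hse0 ha0 hea hint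
  -- The idempotent `v a` satisfies `(v a) A (α_t(e) - v a) = 0`, so simplicity forces `v a = α_t(e)`.
  have hva0 : v * a ≠ 0 := fun h0 => ha0 (by rw [← hea, ← hav, mul_assoc, h0, mul_zero])
  have hann : ∀ x, v * a * x * (α t e - v * a) = 0 := by
    intro x
    obtain ⟨x', hx'⟩ : α t e * x * α t e ∈ Set.range (α t) := (hα t).2.ge ⟨α t e * x * α t e, by
      rw [actionIdem, mul_assoc _ _ (α t 1), mul_assoc (α t e * x), ← map_mul, mul_one,
        ← mul_assoc, ← mul_assoc, ← map_mul, one_mul]⟩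
    have hx : α t (e * x' * e) = α t e * x * α t e := by
      rw [map_mul, map_mul, hx', ← mul_assoc, ← mul_assoc, ← map_mul, he.eq, mul_assoc, ← map_mul,
        he.eq]
    calc v * a * x * (α t e - v * a)
        = v * (a * α t e) * x * (α t e * α t e - α t e * v * a) := by
          rw [hae, hv, ← map_mul, he.eq]
      _ = v * (a * (α t e * x * α t e)) * α t e - v * (a * (α t e * x * α t e)) * (v * a) := by
          noncomm_ring
      _ = v * (a * α t (e * x' * e)) - v * α s (e * x' * e) * (a * v) * a := by
          rw [← hx, mul_assoc v (a * _) (α t e), mul_assoc a _ (α t e), ← map_mul,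
            mul_assoc (e * x'), he.eq, ← hint]
          noncomm_ring
      _ = 0 := by
          rw [hav, mul_assoc v (α s _) (α s e), ← map_mul, mul_assoc (e * x'), he.eq, ← hint]
          noncomm_ring
  have hva : v * a = α t e := by
    obtain ⟨n, y, z, hyz⟩ := IsSimpleRing.exists_sum_mul_mul_eq_one hva0
    refine (sub_eq_zero.mp ?_).symm
    rw [← one_mul (α t e - v * a), ← hyz, Finset.sum_mul]
    refine Finset.sum_eq_zero fun i _ => ?_
    rw [mul_assoc (y i), mul_assoc (y i), hann, mul_zero]
  exact isInnerPair_of_corner he he0 hav hva hint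

end Inner

/-! ### Comparison of idempotents in ultramatricial algebras -/

section Rank

variable {k V : Type*} [Field k] [AddCommGroup V] [Module k V] [FiniteDimensional k V]

open Module

theorem Module.End.exists_eq_mul_mul_of_finrank_le (p q : End k V)
    (h : finrank k (LinearMap.range p) ≤ finrank k (LinearMap.range q)) :
    ∃ a b : End k V, p = a * q * b := by
  obtain ⟨j, hj⟩ := finrank_le_iff_exists_linearMap.mp h
  obtain ⟨r, hr⟩ := q.rangeRestrict.exists_rightInverse_of_surjective q.range_rangeRestrict
  obtain ⟨l, hl⟩ := ((LinearMap.range q).subtype ∘ₗ j).exists_leftInverse_of_injective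
    (LinearMap.ker_eq_bot.mpr ((Subtype.val_injective).comp hj))
  refine ⟨(LinearMap.range p).subtype ∘ₗ l, r ∘ₗ j ∘ₗ p.rangeRestrict, ?_⟩
  ext x
  have h1 : q (r (j (p.rangeRestrict x))) = j (p.rangeRestrict x) :=
    congrArg Subtype.val (LinearMap.congr_fun hr (j (p.rangeRestrict x)))
  have h2 : l (j (p.rangeRestrict x)) = p.rangeRestrict x := LinearMap.congr_fun hl _
  simp only [Module.End.mul_apply, LinearMap.comp_apply, h1, Submodule.subtype_apply, h2]
  rfl

theorem Module.End.finrank_range_add_le {p p' : End k V} (hp : IsIdempotentElem p')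
    (h1 : p * p' = p') (h2 : p' * p = p') :
    finrank k (LinearMap.range (p - p')) + finrank k (LinearMap.range p') ≤
      finrank k (LinearMap.range p) := by
  have hdisj : LinearMap.range (p - p') ⊓ LinearMap.range p' = ⊥ := by
    rw [eq_bot_iff]
    rintro _ ⟨⟨x, rfl⟩, ⟨y, hy⟩⟩
    have h3 : p' * (p - p') = 0 := by rw [mul_sub, h2, hp.eq, sub_self]
    have h4 : p' ((p - p') x) = 0 := LinearMap.congr_fun h3 x
    have h5 : p' (p' y) = p' y := LinearMap.congr_fun hp.eq y
    rw [← hy, h5, hy] at h4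
    exact h4
  have h := Submodule.finrank_sup_add_finrank_inf_eq (LinearMap.range (p - p')) (LinearMap.range p')
  rw [hdisj, finrank_bot, add_zero] at h
  rw [← h]
  refine Submodule.finrank_mono (sup_le ?_ ?_)
  · rintro _ ⟨x, rfl⟩
    exact ⟨x - p' x, by
      rw [map_sub, LinearMap.sub_apply]
      congr 1
      exact LinearMap.congr_fun h1 x⟩
  · rintro _ ⟨x, rfl⟩
    exact ⟨p' x, LinearMap.congr_fun h1 x⟩

theorem Module.End.finrank_range_sum_mul_mul_le (q : End k V) {n : ℕ} (x y : Fin n → End k V) :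
    finrank k (LinearMap.range (∑ i, x i * q * y i)) ≤ n * finrank k (LinearMap.range q) := by
  have key : ∀ x y : End k V, finrank k (LinearMap.range (x * q * y)) ≤
      finrank k (LinearMap.range q) := by
    intro x y
    calc finrank k (LinearMap.range (x * q * y)) ≤ finrank k ((LinearMap.range q).map x) := by
          refine Submodule.finrank_mono ?_
          rintro _ ⟨v, rfl⟩
          exact ⟨q (y v), ⟨_, rfl⟩, rfl⟩
      _ ≤ _ := Submodule.finrank_map_le _ _
  have hsum : ∀ s : Finset (Fin n), finrank k (LinearMap.range (∑ i ∈ s, x i * q * y i)) ≤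
      s.card * finrank k (LinearMap.range q) := by
    intro s
    induction s using Finset.induction_on with
    | empty =>
      rw [Finset.sum_empty, Finset.card_empty, zero_mul]
      change finrank k (LinearMap.range (0 : V →ₗ[k] V)) ≤ 0
      rw [LinearMap.range_zero, finrank_bot]
    | insert i s hi ih =>
      rw [Finset.sum_insert hi, Finset.card_insert_of_notMem hi]
      calc _ ≤ finrank k ((LinearMap.range (x i * q * y i) ⊔
              LinearMap.range (∑ i ∈ s, x i * q * y i) : Submodule k V)) := by
            refine Submodule.finrank_mono ?_
            rintro _ ⟨v, rfl⟩
            exact Submodule.add_mem_sup ⟨v, rfl⟩ ⟨v, rfl⟩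
        _ ≤ _ := Submodule.finrank_add_le_finrank_add_finrank _ _
        _ ≤ _ := by rw [add_mul, one_mul, add_comm]; exact add_le_add ih (key _ _)
  simpa using hsum Finset.univ

/-- Data in a ring which force `p n` to be dominated by `q`: a decreasing chain of idempotents
`p 0 = 1, …, p n`, each of which is a sum of `K` translates of the next difference
`p i - p (i + 1)`, so that ranks shrink by the factor `(K - 1) / K` at each step, while `1` is a
sum of `m` translates of `q`. -/
structure IsShrinkingChain {B : Type*} [Ring B] (n K m : ℕ) (p : ℕ → B) (q : B)
    (x y : ℕ → Fin K → B) (x' y' : Fin m → B) : Prop where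
  zero : p 0 = 1
  idem : ∀ i ≤ n, IsIdempotentElem (p i)
  mul_left : ∀ i < n, p i * p (i + 1) = p (i + 1)
  mul_right : ∀ i < n, p (i + 1) * p i = p (i + 1)
  sum : ∀ i < n, p i = ∑ j, x i j * (p i - p (i + 1)) * y i j
  one : 1 = ∑ j, x' j * q * y' j

theorem IsShrinkingChain.map {B C : Type*} [Ring B] [Ring C] {n K m : ℕ} {p : ℕ → B} {q : B}
    {x y : ℕ → Fin K → B} {x' y' : Fin m → B} (h : IsShrinkingChain n K m p q x y x' y')
    (φ : B →+* C) :
    IsShrinkingChain n K m (fun i => φ (p i)) (φ q) (fun i j => φ (x i j)) (fun i j => φ (y i j))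
      (fun j => φ (x' j)) (fun j => φ (y' j)) where
  zero := by rw [h.zero, map_one]
  idem i hi := (h.idem i hi).map φ
  mul_left i hi := by rw [← map_mul, h.mul_left i hi]
  mul_right i hi := by rw [← map_mul, h.mul_right i hi]
  sum i hi := by simp only [← map_sub, ← map_mul, ← map_sum]; rw [← h.sum i hi]
  one := by simp only [← map_mul, ← map_sum]; rw [← h.one, map_one]

theorem IsShrinkingChain.exists_eq_mul_mul_end {n K m : ℕ} {p : ℕ → End k V} {q : End k V}
    {x y : ℕ → Fin K → End k V} {x' y' : Fin m → End k V}
    (h : IsShrinkingChain n K m p q x y x' y') (hK : K ≠ 0) (hn : m * (K - 1) ^ n ≤ K ^ n) :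
    ∃ a b, p n = a * q * b := by
  apply Module.End.exists_eq_mul_mul_of_finrank_le
  let r : End k V → ℕ := fun f => finrank k (LinearMap.range f)
  have hstep : ∀ i < n, K * r (p (i + 1)) ≤ (K - 1) * r (p i) := by
    intro i hi
    have h1 : r (p i - p (i + 1)) + r (p (i + 1)) ≤ r (p i) :=
      Module.End.finrank_range_add_le (h.idem _ hi) (h.mul_left i hi) (h.mul_right i hi)
    have h2 : r (p i) ≤ K * r (p i - p (i + 1)) := by
      have := Module.End.finrank_range_sum_mul_mul_le (p i - p (i + 1)) (x i) (y i)
      rwa [← h.sum i hi] at this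
    obtain ⟨K, rfl⟩ := Nat.exists_eq_succ_of_ne_zero hK
    simp only [Nat.succ_eq_add_one, Nat.add_sub_cancel] at *
    have h3 := Nat.mul_le_mul_left (K + 1) h1
    rw [mul_add] at h3
    rw [add_mul K 1 (r (p i)), one_mul] at h3
    omega
  have hpow : ∀ i ≤ n, K ^ i * r (p i) ≤ (K - 1) ^ i * r 1 := by
    intro i hi
    induction i with
    | zero => rw [h.zero]; simp
    | succ i ih =>
      calc K ^ (i + 1) * r (p (i + 1)) = K ^ i * (K * r (p (i + 1))) := by ring
        _ ≤ K ^ i * ((K - 1) * r (p i)) := Nat.mul_le_mul_left _ (hstep i hi)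
        _ = (K - 1) * (K ^ i * r (p i)) := by ring
        _ ≤ (K - 1) * ((K - 1) ^ i * r 1) := Nat.mul_le_mul_left _ (ih (by omega))
        _ = _ := by ring
  have hone : r 1 ≤ m * r q := by
    have := Module.End.finrank_range_sum_mul_mul_le q x' y'
    rwa [← h.one] at this
  refine Nat.le_of_mul_le_mul_left ?_ (pow_pos (Nat.pos_of_ne_zero hK) n)
  calc K ^ n * r (p n) ≤ (K - 1) ^ n * r 1 := hpow n le_rfl
    _ ≤ (K - 1) ^ n * (m * r q) := Nat.mul_le_mul_left _ hone
    _ = m * (K - 1) ^ n * r q := by ring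
    _ ≤ K ^ n * r q := Nat.mul_le_mul_right _ hn

theorem IsShrinkingChain.exists_eq_mul_mul {B : Type*} [Ring B] [Algebra k B]
    (hB : IsMatricial k B) {n K m : ℕ} {p : ℕ → B} {q : B}
    {x y : ℕ → Fin K → B} {x' y' : Fin m → B}
    (h : IsShrinkingChain n K m p q x y x' y') (hK : K ≠ 0) (hn : m * (K - 1) ^ n ≤ K ^ n) :
    ∃ a b, p n = a * q * b := by
  obtain ⟨r, d, -, ⟨Φ⟩⟩ := hB
  have hi : ∀ i : Fin r, ∃ a b : Matrix (Fin (d i)) (Fin (d i)) k, Φ (p n) i = a * Φ q i * b := by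
    intro i
    let Ψ : Matrix (Fin (d i)) (Fin (d i)) k ≃ₐ[k] End k (Fin (d i) → k) := Matrix.toLinAlgEquiv'
    let φ : B →+* End k (Fin (d i) → k) :=
      Ψ.toRingEquiv.toRingHom.comp
        ((Pi.evalRingHom (fun i => Matrix (Fin (d i)) (Fin (d i)) k) i).comp
          Φ.toRingEquiv.toRingHom)
    obtain ⟨a, b, hab⟩ := (h.map φ).exists_eq_mul_mul_end hK hn
    refine ⟨Ψ.symm a, Ψ.symm b, Ψ.injective ?_⟩
    rw [map_mul, map_mul, Ψ.apply_symm_apply, Ψ.apply_symm_apply]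
    exact hab
  choose a b hab using hi
  refine ⟨Φ.symm a, Φ.symm b, Φ.injective ?_⟩
  rw [map_mul, map_mul, Φ.apply_symm_apply, Φ.apply_symm_apply]
  exact funext hab

end Rank

theorem Nat.exists_mul_sub_one_pow_le_pow {K : ℕ} (hK : K ≠ 0) (m : ℕ) :
    ∃ n, m * (K - 1) ^ n ≤ K ^ n := by
  obtain ⟨K, rfl⟩ := Nat.exists_eq_succ_of_ne_zero hK
  simp only [Nat.succ_eq_add_one, Nat.add_sub_cancel]
  obtain ⟨n, hn⟩ := exists_pow_lt_of_lt_one (show (0 : ℚ) < 1 / (m + 1) by positivity)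
    (show (K : ℚ) / (K + 1) < 1 by rw [div_lt_one (by positivity)]; linarith)
  refine ⟨n, ?_⟩
  rw [div_pow, div_lt_div_iff₀ (by positivity) (by positivity)] at hn
  have h : ((m * K ^ n : ℕ) : ℚ) ≤ ((K + 1) ^ n : ℕ) := by
    push_cast
    nlinarith [pow_nonneg (Nat.cast_nonneg (α := ℚ) K) n]
  exact_mod_cast h

/-- Let `σ` be a not necessarily unital, ring endomorphism of a simple ultramatricial
algebra with `σ 1 ≠ 1`. Then the idempotents `σⁿ(1)` become dominated by any given nonzero
element. -/
theorem IsUltramatricial.exists_iterate_eq_mul_mul {k A : Type*} [Field k] [Ring A] [Algebra k A]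
    [IsSimpleRing A] (hA : IsUltramatricial k A) (σ : A →ₙ+* A) (hσ : σ 1 ≠ 1) {q : A}
    (hq : q ≠ 0) : ∃ (n : ℕ) (a b : A), σ^[n] 1 = a * q * b := by
  obtain ⟨B, hmono, hmat, hex⟩ := hA
  obtain ⟨K, x, y, hxy⟩ := IsSimpleRing.exists_sum_mul_mul_eq_one (sub_ne_zero.mpr hσ.symm)
  obtain ⟨m, x', y', hxy'⟩ := IsSimpleRing.exists_sum_mul_mul_eq_one hq
  have hK : K ≠ 0 := by
    rintro rfl
    simp at hxy
  obtain ⟨n, hn⟩ := Nat.exists_mul_sub_one_pow_le_pow hK m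
  choose N hN using hex
  -- a stage of the union that contains all the elements involved
  obtain ⟨M, hM⟩ : ∃ M, (∀ i ≤ n, N (σ^[i] 1) ≤ M) ∧ (∀ i < n, ∀ j, N (σ^[i] (x j)) ≤ M) ∧
      (∀ i < n, ∀ j, N (σ^[i] (y j)) ≤ M) ∧ (∀ j, N (x' j) ≤ M) ∧ (∀ j, N (y' j) ≤ M) ∧
      N q ≤ M := by
    let s1 := (Finset.range (n + 1)).sup fun i => N (σ^[i] 1)
    let s2 := (Finset.range n).sup fun i => Finset.univ.sup fun j => N (σ^[i] (x j))
    let s3 := (Finset.range n).sup fun i => Finset.univ.sup fun j => N (σ^[i] (y j))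
    let s4 := Finset.univ.sup fun j => N (x' j)
    let s5 := Finset.univ.sup fun j => N (y' j)
    refine ⟨s1 + s2 + s3 + s4 + s5 + N q, fun i hi => ?_, fun i hi j => ?_, fun i hi j => ?_,
      fun j => ?_, fun j => ?_, by omega⟩
    · have : N (σ^[i] 1) ≤ s1 :=
        Finset.le_sup (f := fun i => N (σ^[i] 1)) (Finset.mem_range.mpr (by omega))
      omega
    · have : N (σ^[i] (x j)) ≤ s2 :=
        (Finset.le_sup (f := fun j => N (σ^[i] (x j))) (Finset.mem_univ j)).trans
          (Finset.le_sup (f := fun i => Finset.univ.sup fun j => N (σ^[i] (x j)))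
            (Finset.mem_range.mpr hi))
      omega
    · have : N (σ^[i] (y j)) ≤ s3 :=
        (Finset.le_sup (f := fun j => N (σ^[i] (y j))) (Finset.mem_univ j)).trans
          (Finset.le_sup (f := fun i => Finset.univ.sup fun j => N (σ^[i] (y j)))
            (Finset.mem_range.mpr hi))
      omega
    · have : N (x' j) ≤ s4 := Finset.le_sup (f := fun j => N (x' j)) (Finset.mem_univ j)
      omega
    · have : N (y' j) ≤ s5 := Finset.le_sup (f := fun j => N (y' j)) (Finset.mem_univ j)
      omega
  have mem : ∀ a, N a ≤ M → a ∈ B M := fun a ha => hmono ha (hN a)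
  -- elements outside the stage, which do not matter, are replaced by `0`
  classical
  let c : A → B M := fun a => if h : a ∈ B M then ⟨a, h⟩ else 0
  have hc : ∀ a, N a ≤ M → (c a : A) = a := fun a ha => by simp only [c, dif_pos (mem a ha)]
  have hmulσ : ∀ i (a b : A), σ^[i] (a * b) = σ^[i] a * σ^[i] b := fun i =>
    Function.Semiconj₂.iterate (fun a b => map_mul σ a b) i
  have haddσ : ∀ i (a b : A), σ^[i] (a - b) = σ^[i] a - σ^[i] b := fun i =>
    Function.Semiconj₂.iterate (fun a b => map_sub σ a b) i
  have hsumσ : ∀ i (f : Fin K → A), σ^[i] (∑ j, f j) = ∑ j, σ^[i] (f j) := by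
    intro i f
    induction i with
    | zero => rfl
    | succ i ih => simp only [Function.iterate_succ_apply', ih, map_sum]
  obtain ⟨a, b, hab⟩ := IsShrinkingChain.exists_eq_mul_mul (hmat M) (n := n) (K := K) (m := m)
    (p := fun i => c (σ^[i] 1)) (q := c q) (x := fun i j => c (σ^[i] (x j)))
    (y := fun i j => c (σ^[i] (y j))) (x' := fun j => c (x' j)) (y' := fun j => c (y' j))
    { zero := Subtype.ext (hc _ (hM.1 0 (Nat.zero_le _)))
      idem := fun i hi => Subtype.ext (by
        rw [MulMemClass.coe_mul, hc _ (hM.1 i hi), ← hmulσ, one_mul])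
      mul_left := fun i hi => Subtype.ext (by
        rw [MulMemClass.coe_mul, hc _ (hM.1 i hi.le), hc _ (hM.1 (i + 1) hi),
          Function.iterate_succ_apply, ← hmulσ, one_mul])
      mul_right := fun i hi => Subtype.ext (by
        rw [MulMemClass.coe_mul, hc _ (hM.1 i hi.le), hc _ (hM.1 (i + 1) hi),
          Function.iterate_succ_apply, ← hmulσ, mul_one])
      sum := fun i hi => Subtype.ext (by
        rw [AddSubmonoidClass.coe_finsetSum, hc _ (hM.1 i hi.le)]
        conv_lhs => rw [← hxy, hsumσ]
        refine Finset.sum_congr rfl fun j _ => ?_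
        rw [MulMemClass.coe_mul, MulMemClass.coe_mul, AddSubgroupClass.coe_sub,
          hc _ (hM.1 i hi.le), hc _ (hM.1 (i + 1) hi), hc _ (hM.2.1 i hi j),
          hc _ (hM.2.2.1 i hi j), hmulσ, hmulσ, haddσ, Function.iterate_succ_apply])
      one := Subtype.ext (by
        rw [AddSubmonoidClass.coe_finsetSum, OneMemClass.coe_one, ← hxy']
        refine Finset.sum_congr rfl fun j _ => ?_
        rw [MulMemClass.coe_mul, MulMemClass.coe_mul, hc _ (hM.2.2.2.1 j),
          hc _ (hM.2.2.2.2.1 j), hc _ hM.2.2.2.2.2]) } hK hn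
  refine ⟨n, a, b, ?_⟩
  rw [← hc _ (hM.1 n le_rfl), ← hc q hM.2.2.2.2.2]
  exact congrArg Subtype.val hab

/-! ### Homogeneous elements of the fractional skew monoid ring -/

namespace FracSkewMonoidRing

section Relations

variable {A S : Type*} [Ring A] [Monoid S] (α : S →* (A →ₙ+* A))

theorem plusHom_mul_coeffHom (s : S) (a : A) :
    plusHom α s * coeffHom α a = coeffHom α (α s a) * plusHom α s := (compatible α).1 s a

theorem coeffHom_mul_minusHom (s : S) (a : A) :
    coeffHom α a * minusHom α (.op s) = minusHom α (.op s) * coeffHom α (α s a) :=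
  (compatible α).2.1 s a

theorem minusHom_mul_plusHom (s : S) : minusHom α (.op s) * plusHom α s = 1 :=
  (compatible α).2.2.1 s

theorem plusHom_mul_minusHom (s : S) :
    plusHom α s * minusHom α (.op s) = coeffHom α (α s 1) := (compatible α).2.2.2 s

theorem minusHom_op_mul (s t : S) :
    minusHom α (.op (s * t)) = minusHom α (.op t) * minusHom α (.op s) := by
  rw [MulOpposite.op_mul, map_mul]

/-- The element `s₋ φ(a) t₊`, which is homogeneous of degree `s⁻¹ t`. -/
noncomputable def monomial (s : S) (a : A) (t : S) : FracSkewMonoidRing α :=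
  minusHom α (.op s) * coeffHom α a * plusHom α t

theorem monomial_add (s : S) (a b : A) (t : S) :
    monomial α s (a + b) t = monomial α s a t + monomial α s b t := by
  rw [monomial, map_add, mul_add, add_mul, monomial, monomial]

theorem monomial_eq_mul_left (x s : S) (a : A) (t : S) :
    monomial α s a t = monomial α (x * s) (α x a) (x * t) := by
  have h : coeffHom α a = minusHom α (.op x) * coeffHom α (α x a) * plusHom α x := by
    rw [← coeffHom_mul_minusHom, mul_assoc, minusHom_mul_plusHom, mul_one]
  rw [monomial, monomial, minusHom_op_mul, map_mul, h]
  simp only [mul_assoc]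

theorem monomial_eq_corner (s : S) (a : A) (t : S) :
    monomial α s a t = monomial α s (α s 1 * a * α t 1) t := by
  have h1 : minusHom α (.op s) = minusHom α (.op s) * coeffHom α (α s 1) := by
    rw [← coeffHom_mul_minusHom, map_one, one_mul]
  have h2 : plusHom α t = coeffHom α (α t 1) * plusHom α t := by
    rw [← plusHom_mul_coeffHom, map_one, mul_one]
  rw [monomial, monomial]
  conv_lhs => rw [h1, h2]
  simp only [map_mul, mul_assoc]

theorem coeffHom_mul_monomial (b : A) (s : S) (a : A) (t : S) :
    coeffHom α b * monomial α s a t = monomial α s (α s b * a) t := by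
  rw [monomial, monomial, ← mul_assoc, ← mul_assoc, coeffHom_mul_minusHom, map_mul]
  simp only [mul_assoc]

theorem monomial_mul_coeffHom (s : S) (a : A) (t : S) (b : A) :
    monomial α s a t * coeffHom α b = monomial α s (a * α t b) t := by
  rw [monomial, monomial, mul_assoc, plusHom_mul_coeffHom, map_mul]
  simp only [mul_assoc]

theorem minusHom_mul_monomial (r s : S) (a : A) (t : S) :
    minusHom α (.op r) * monomial α s a t = monomial α (s * r) a t := by
  rw [monomial, monomial, minusHom_op_mul]
  simp only [mul_assoc]

theorem plusHom_mul_monomial_mul_minusHom (s : S) (a : A) (t : S) :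
    plusHom α s * monomial α s a t * minusHom α (.op t) = coeffHom α (α s 1 * a * α t 1) := by
  have h : plusHom α s * monomial α s a t * minusHom α (.op t) =
      (plusHom α s * minusHom α (.op s)) * coeffHom α a *
        (plusHom α t * minusHom α (.op t)) := by
    rw [monomial]; simp only [mul_assoc]
  rw [h, plusHom_mul_minusHom, plusHom_mul_minusHom, map_mul, map_mul]

/-- The left Ore condition `x r = y s` rewrites `r₊ s₋` with the minus part in front. -/
theorem plusHom_mul_monomial {x y r s : S} (h : x * r = y * s) (a : A) (t : S) :
    plusHom α r * monomial α s a t = monomial α x (α (y * s) 1 * α y a) (y * t) := by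
  have h1 : plusHom α r = minusHom α (.op x) * (plusHom α y * plusHom α s) := by
    rw [← map_mul, ← h, map_mul, ← mul_assoc, minusHom_mul_plusHom, one_mul]
  have h2 : plusHom α r * monomial α s a t = minusHom α (.op x) * (plusHom α y *
      ((plusHom α s * minusHom α (.op s)) * (coeffHom α a * plusHom α t))) := by
    rw [h1, monomial]; simp only [mul_assoc]
  have h3 : ∀ b : A, ∀ z, plusHom α y * (coeffHom α b * z) =
      coeffHom α (α y b) * (plusHom α y * z) := fun b z => by
    rw [← mul_assoc, plusHom_mul_coeffHom, mul_assoc]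
  rw [h2, plusHom_mul_minusHom, h3, h3, ← map_mul, monomial, map_mul α y s]
  simp only [map_mul, mul_assoc]
  rfl

theorem induction_on {P : FracSkewMonoidRing α → Prop}
    (hcoeff : ∀ a, P (coeffHom α a)) (hplus : ∀ s, P (plusHom α s))
    (hminus : ∀ s, P (minusHom α (.op s))) (hadd : ∀ x y, P x → P y → P (x + y))
    (hmul : ∀ x y, P x → P y → P (x * y)) (x : FracSkewMonoidRing α) : P x := by
  obtain ⟨y, rfl⟩ : ∃ y, mk α y = x := RingQuot.mkRingHom_surjective _ x
  induction y using FreeAlgebra.induction with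
  | grade0 n =>
    have h : mk α (algebraMap ℤ _ n) = coeffHom α n := by
      rw [eq_intCast, map_intCast, map_intCast]
    rw [h]; exact hcoeff _
  | grade1 g =>
    cases g with
    | coeff a => exact hcoeff a
    | plus s => exact hplus s
    | minus s => exact hminus s
  | mul a b ha hb => rw [map_mul]; exact hmul _ _ ha hb
  | add a b ha hb => rw [map_add]; exact hadd _ _ ha hb

end Relations

section Grading

variable {G : Type*} [Group G] {S : Submonoid G} {A : Type*} [Ring A] (α : S →* (A →ₙ+* A))

theorem exists_mul_eq_mul (hG : ∀ g : G, ∃ s ∈ S, ∃ t ∈ S, g = s⁻¹ * t) (r s : S) :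
    ∃ x y : S, x * r = y * s := by
  obtain ⟨x, hx, y, hy, h⟩ := hG (r * (s : G)⁻¹)
  refine ⟨⟨x, hx⟩, ⟨y, hy⟩, Subtype.ext ?_⟩
  calc x * r = x * (r * (s : G)⁻¹) * s := by group
    _ = y * s := by rw [h]; group

theorem mem_closure_monomial (hG : ∀ g : G, ∃ s ∈ S, ∃ t ∈ S, g = s⁻¹ * t)
    (x : FracSkewMonoidRing α) :
    x ∈ AddSubgroup.closure {y | ∃ s a t, y = monomial α s a t} := by
  have h1 : (1 : FracSkewMonoidRing α) ∈ AddSubgroup.closure {y | ∃ s a t, y = monomial α s a t} :=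
    AddSubgroup.subset_closure ⟨1, 1, 1, by simp [monomial]⟩
  -- the span of the monomials is stable under left multiplication by the generators
  suffices h : ∀ z ∈ AddSubgroup.closure {y | ∃ s a t, y = monomial α s a t},
      x * z ∈ AddSubgroup.closure {y | ∃ s a t, y = monomial α s a t} by
    simpa using h 1 h1
  have key : ∀ x : FracSkewMonoidRing α,
      (∀ s a t, ∃ s' a' t', x * monomial α s a t = monomial α s' a' t') →
      ∀ z ∈ AddSubgroup.closure {y | ∃ s a t, y = monomial α s a t},
        x * z ∈ AddSubgroup.closure {y | ∃ s a t, y = monomial α s a t} := by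
    intro x hx z hz
    induction hz using AddSubgroup.closure_induction with
    | mem z hz =>
      obtain ⟨s, a, t, rfl⟩ := hz
      exact AddSubgroup.subset_closure (hx s a t)
    | zero => rw [mul_zero]; exact zero_mem _
    | add a b _ _ ha hb => rw [mul_add]; exact add_mem ha hb
    | neg a _ ha => rw [mul_neg]; exact neg_mem ha
  induction x using induction_on with
  | hcoeff b => exact key _ fun s a t => ⟨_, _, _, coeffHom_mul_monomial α b s a t⟩
  | hplus r =>
    refine key _ fun s a t => ?_
    obtain ⟨x, y, h⟩ := exists_mul_eq_mul hG r s
    exact ⟨_, _, _, plusHom_mul_monomial α h a t⟩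
  | hminus r => exact key _ fun s a t => ⟨_, _, _, minusHom_mul_monomial α r s a t⟩
  | hadd x y hx hy => exact fun z hz => by rw [add_mul]; exact add_mem (hx z hz) (hy z hz)
  | hmul x y hx hy => exact fun z hz => by rw [mul_assoc]; exact hx _ (hy z hz)

theorem exists_grading :
    ∃ γ : FracSkewMonoidRing α →+* MonoidAlgebra (FracSkewMonoidRing α) G,
      (∀ a, γ (coeffHom α a) = MonoidAlgebra.single 1 (coeffHom α a)) ∧
      (∀ s : S, γ (plusHom α s) = MonoidAlgebra.single (s : G) (plusHom α s)) ∧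
      ∀ s : Sᵐᵒᵖ, γ (minusHom α s) = MonoidAlgebra.single (s.unop : G)⁻¹ (minusHom α s) := by
  let p : S →* MonoidAlgebra (FracSkewMonoidRing α) G :=
    { toFun := fun s => MonoidAlgebra.single (s : G) (plusHom α s)
      map_one' := by rw [map_one]; rfl
      map_mul' := fun s t => by rw [MonoidAlgebra.single_mul_single, map_mul]; rfl }
  let m : Sᵐᵒᵖ →* MonoidAlgebra (FracSkewMonoidRing α) G :=
    { toFun := fun s => MonoidAlgebra.single (s.unop : G)⁻¹ (minusHom α s)
      map_one' := by rw [map_one, MulOpposite.unop_one, Submonoid.coe_one, inv_one]; rfl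
      map_mul' := fun s t => by
        rw [MonoidAlgebra.single_mul_single, map_mul, MulOpposite.unop_mul, Submonoid.coe_mul,
          mul_inv_rev] }
  refine (existsUnique_lift α (MonoidAlgebra.singleOneRingHom.comp (coeffHom α)) p m
    ⟨fun s a => ?_, fun s a => ?_, fun s => ?_, fun s => ?_⟩).exists
  · change MonoidAlgebra.single _ _ * MonoidAlgebra.single _ _ =
      MonoidAlgebra.single _ _ * MonoidAlgebra.single _ _
    rw [MonoidAlgebra.single_mul_single, MonoidAlgebra.single_mul_single, mul_one, one_mul,
      plusHom_mul_coeffHom]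
  · change MonoidAlgebra.single _ _ * MonoidAlgebra.single _ _ =
      MonoidAlgebra.single _ _ * MonoidAlgebra.single _ _
    rw [MonoidAlgebra.single_mul_single, MonoidAlgebra.single_mul_single, mul_one, one_mul,
      coeffHom_mul_minusHom]
  · change MonoidAlgebra.single _ _ * MonoidAlgebra.single _ _ = MonoidAlgebra.single _ _
    rw [MonoidAlgebra.single_mul_single, minusHom_mul_plusHom, MulOpposite.unop_op, inv_mul_cancel]
  · change MonoidAlgebra.single _ _ * MonoidAlgebra.single _ _ = MonoidAlgebra.single _ _
    rw [MonoidAlgebra.single_mul_single, plusHom_mul_minusHom, MulOpposite.unop_op, mul_inv_cancel]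
    rfl

/-- The homomorphism from `R` to the group ring `R[G]` sending `φ(a)`, `s₊`, `s₋` to themselves
times `1`, `s`, `s⁻¹`. It encodes the grading of `R` by `G`: the coefficient at `g` of the image of
`x` is the homogeneous component of `x` of degree `g`. -/
noncomputable def grading : FracSkewMonoidRing α →+* MonoidAlgebra (FracSkewMonoidRing α) G :=
  (exists_grading α).choose

theorem grading_coeffHom (a : A) :
    grading α (coeffHom α a) = MonoidAlgebra.single 1 (coeffHom α a) :=
  (exists_grading α).choose_spec.1 a

theorem grading_plusHom (s : S) :
    grading α (plusHom α s) = MonoidAlgebra.single (s : G) (plusHom α s) :=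
  (exists_grading α).choose_spec.2.1 s

theorem grading_minusHom (s : S) :
    grading α (minusHom α (.op s)) = MonoidAlgebra.single (s : G)⁻¹ (minusHom α (.op s)) :=
  (exists_grading α).choose_spec.2.2 (.op s)

theorem grading_monomial (s : S) (a : A) (t : S) :
    grading α (monomial α s a t) =
      MonoidAlgebra.single ((s : G)⁻¹ * t) (monomial α s a t) := by
  rw [monomial, map_mul, map_mul, grading_coeffHom, grading_plusHom, grading_minusHom,
    MonoidAlgebra.single_mul_single, MonoidAlgebra.single_mul_single, mul_one]

/-- The homogeneous component of degree `g`. -/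
noncomputable def component (g : G) (x : FracSkewMonoidRing α) : FracSkewMonoidRing α :=
  (grading α x).coeff g

theorem component_add (g : G) (x y : FracSkewMonoidRing α) :
    component α g (x + y) = component α g x + component α g y := by
  simp [component]

theorem component_neg (g : G) (x : FracSkewMonoidRing α) :
    component α g (-x) = -component α g x := by
  simp [component]

theorem component_zero (g : G) : component α g (0 : FracSkewMonoidRing α) = 0 := by
  simp [component]

/-- The set of degrees in which `x` has a nonzero component. -/
noncomputable def degrees (x : FracSkewMonoidRing α) : Finset G := (grading α x).coeff.support

theorem mem_degrees {x : FracSkewMonoidRing α} {g : G} :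
    g ∈ degrees α x ↔ component α g x ≠ 0 := Finsupp.mem_support_iff

theorem sum_component (hG : ∀ g : G, ∃ s ∈ S, ∃ t ∈ S, g = s⁻¹ * t) (x : FracSkewMonoidRing α) :
    ∑ g ∈ degrees α x, component α g x = x := by
  let aug : MonoidAlgebra (FracSkewMonoidRing α) G →+ FracSkewMonoidRing α :=
    (Finsupp.liftAddHom fun _ => AddMonoidHom.id _).comp MonoidAlgebra.coeffAddEquiv.toAddMonoidHom
  change aug (grading α x) = x
  induction mem_closure_monomial α hG x using AddSubgroup.closure_induction with
  | mem z hz =>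
    obtain ⟨s, a, t, rfl⟩ := hz
    rw [grading_monomial]
    change (Finsupp.liftAddHom fun _ => AddMonoidHom.id _) (Finsupp.single _ _) = _
    rw [Finsupp.liftAddHom_apply_single]; rfl
  | zero => rw [map_zero, map_zero]
  | add a b _ _ ha hb => rw [map_add, map_add, ha, hb]
  | neg a _ ha => rw [map_neg, map_neg, ha]

theorem degrees_nonempty (hG : ∀ g : G, ∃ s ∈ S, ∃ t ∈ S, g = s⁻¹ * t)
    {x : FracSkewMonoidRing α} (hx : x ≠ 0) : (degrees α x).Nonempty := by
  rw [Finset.nonempty_iff_ne_empty]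
  intro h
  apply hx
  rw [← sum_component α hG x, h, Finset.sum_empty]

theorem exists_component_eq_monomial (hG : ∀ g : G, ∃ s ∈ S, ∃ t ∈ S, g = s⁻¹ * t) (g : G)
    (x : FracSkewMonoidRing α) :
    ∃ (s t : S) (a : A), g = (s : G)⁻¹ * t ∧ component α g x = monomial α s a t := by
  obtain ⟨s₀, hs₀, t₀, ht₀, hg⟩ := hG g
  have hzero : ∃ (s t : S) (a : A), g = (s : G)⁻¹ * t ∧ 0 = monomial α s a t :=
    ⟨⟨s₀, hs₀⟩, ⟨t₀, ht₀⟩, 0, hg, by simp [monomial]⟩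
  induction mem_closure_monomial α hG x using AddSubgroup.closure_induction with
  | mem z hz =>
    obtain ⟨s, a, t, rfl⟩ := hz
    rw [component, grading_monomial, MonoidAlgebra.coeff_single]
    by_cases h : (s : G)⁻¹ * t = g
    · exact ⟨s, t, a, h.symm, by rw [h, Finsupp.single_eq_same]⟩
    · rw [Finsupp.single_eq_of_ne (Ne.symm h)]
      exact hzero
  | zero => rw [component_zero]; exact hzero
  | add y z _ _ hy hz =>
    obtain ⟨s, t, a, h, hy⟩ := hy
    obtain ⟨s', t', a', h', hz⟩ := hz
    obtain ⟨u, v, huv⟩ := exists_mul_eq_mul hG s s'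
    have huv' : u * t = v * t' := by
      apply Subtype.ext
      have h1 : (u * s : G) = v * s' := congrArg Subtype.val huv
      have h2 : (s : G)⁻¹ * t = (s' : G)⁻¹ * t' := h.symm.trans h'
      calc (u * t : G) = u * s * ((s : G)⁻¹ * t) := by group
        _ = v * t' := by rw [h1, h2]; group
    refine ⟨u * s, u * t, α u a + α v a', ?_, ?_⟩
    · rw [h, Submonoid.coe_mul, Submonoid.coe_mul]; group
    · rw [component_add, hy, hz, monomial_add, ← monomial_eq_mul_left, huv, huv',
        ← monomial_eq_mul_left]
  | neg y _ hy =>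
    obtain ⟨s, t, a, h, hy⟩ := hy
    exact ⟨s, t, -a, h, by simp [component_neg, hy, monomial]⟩

variable {α}

theorem component_mul_mul {y z : FracSkewMonoidRing α} {g h : G}
    (hy : grading α y = MonoidAlgebra.single g y) (hz : grading α z = MonoidAlgebra.single h z)
    (x : FracSkewMonoidRing α) (k : G) :
    component α k (y * x * z) = y * component α (g⁻¹ * (k * h⁻¹)) x * z := by
  rw [component, map_mul, map_mul, hy, hz, MonoidAlgebra.coeff_mul_single_apply,
    MonoidAlgebra.coeff_single_mul_apply, component]

theorem component_coeffHom_mul_mul (b c : A) (x : FracSkewMonoidRing α) (k : G) :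
    component α k (coeffHom α b * x * coeffHom α c) =
      coeffHom α b * component α k x * coeffHom α c := by
  rw [component_mul_mul (grading_coeffHom α b) (grading_coeffHom α c), inv_one, mul_one, one_mul]

/-- Multiplying by homogeneous elements does not increase the number of homogeneous components. -/
theorem card_degrees_mul_mul_le {y z : FracSkewMonoidRing α} {g h : G}
    (hy : grading α y = MonoidAlgebra.single g y) (hz : grading α z = MonoidAlgebra.single h z)
    (x : FracSkewMonoidRing α) : (degrees α (y * x * z)).card ≤ (degrees α x).card := by
  refine Finset.card_le_card_of_injOn (fun k => g⁻¹ * (k * h⁻¹)) (fun m hm => ?_)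
    fun a _ b _ hab => by simpa using hab
  have hm' : component α m (y * x * z) ≠ 0 := (mem_degrees α).mp hm
  rw [component_mul_mul hy hz] at hm'
  exact (mem_degrees α).mpr fun h0 => hm' (by rw [h0, mul_zero, zero_mul])

/-- Multiplying by elements of `φ(A)` decreases the number of homogeneous components if one of
them is annihilated. -/
theorem card_degrees_coeffHom_mul_mul_lt {b c : A} {x : FracSkewMonoidRing α} {k : G}
    (hk : k ∈ degrees α x) (hk0 : coeffHom α b * component α k x * coeffHom α c = 0) :
    (degrees α (coeffHom α b * x * coeffHom α c)).card < (degrees α x).card := by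
  refine Finset.card_lt_card (Finset.ssubset_iff_of_subset (fun m hm => ?_) |>.mpr ⟨k, hk, ?_⟩)
  · rw [mem_degrees, component_coeffHom_mul_mul] at hm
    exact (mem_degrees α).mpr fun h0 => hm (by rw [h0, mul_zero, zero_mul])
  · rw [mem_degrees, component_coeffHom_mul_mul, hk0]
    exact fun h => h rfl

end Grading

end FracSkewMonoidRing

/-! ### The coefficient ring embeds -/

namespace FracSkewMonoidRing

section Embedding

variable {G : Type*} [Group G] {S : Submonoid G} {A : Type*} [Ring A] {α : S →* (A →ₙ+* A)}

/-- A covariant pair, consisting of a ring homomorphism `j : A → E`, not necessarily unital, and a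
multiplicative map `θ : G → E` with `θ_s j(a) = j(α_s(a)) θ_s`, gives a representation of
`Sᵒᵖ *_α A *_α S` on the corner `j(1) E j(1)`, in which `φ(a)` acts as `j(a)`, `s₊` as `θ_s j(1)`
and `s₋` as `j(1) θ_s⁻¹`. -/
theorem coeffHom_injective_of_covariant {E : Type*} [Ring E] (j : A →ₙ+* E)
    (hj : Function.Injective j) (θ : G →* E) (h : ∀ (s : S) a, θ s * j a = j (α s a) * θ s) :
    Function.Injective (coeffHom α) := by
  have he : IsIdempotentElem (j 1) := by rw [IsIdempotentElem, ← map_mul, one_mul]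
  have h1 : ∀ a, j 1 * j a = j a := fun a => by rw [← map_mul, one_mul]
  have h2 : ∀ a, j a * j 1 = j a := fun a => by rw [← map_mul, mul_one]
  have hθ : ∀ s : S, θ s * θ (s : G)⁻¹ = 1 := fun s => by rw [← map_mul, mul_inv_cancel, map_one]
  have hθ' : ∀ s : S, θ (s : G)⁻¹ * θ s = 1 := fun s => by rw [← map_mul, inv_mul_cancel, map_one]
  have hinv : ∀ (s : S) a, j a * θ (s : G)⁻¹ = θ (s : G)⁻¹ * j (α s a) := fun s a => by
    calc j a * θ (s : G)⁻¹ = (θ (s : G)⁻¹ * θ s) * j a * θ (s : G)⁻¹ := by rw [hθ', one_mul]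
      _ = θ (s : G)⁻¹ * (θ s * j a) * θ (s : G)⁻¹ := by simp only [mul_assoc]
      _ = θ (s : G)⁻¹ * j (α s a) * (θ s * θ (s : G)⁻¹) := by rw [h]; simp only [mul_assoc]
      _ = _ := by rw [hθ, mul_one]
  have hp : ∀ s : S, j 1 * (θ s * j 1) = θ s * j 1 := fun s => by
    rw [h, ← mul_assoc, h1]
  have hm : ∀ s : S, j 1 * θ (s : G)⁻¹ * j 1 = j 1 * θ (s : G)⁻¹ := fun s => by
    rw [hinv, mul_assoc, h2]
  let f : A →+* he.Corner :=
    { toFun := fun a => ⟨j a, (Subsemigroup.mem_corner_iff he).mpr ⟨h1 a, h2 a⟩⟩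
      map_one' := rfl
      map_zero' := Subtype.ext (map_zero j)
      map_mul' := fun a b => Subtype.ext (map_mul j a b)
      map_add' := fun a b => Subtype.ext (map_add j a b) }
  let p : S →* he.Corner :=
    { toFun := fun s => ⟨θ s * j 1, (Subsemigroup.mem_corner_iff he).mpr
        ⟨hp s, by rw [mul_assoc, h1]⟩⟩
      map_one' := Subtype.ext (by
        change θ (1 : S) * j 1 = j 1
        rw [Submonoid.coe_one, map_one θ, one_mul])
      map_mul' := fun s t => Subtype.ext (by
        change θ (s * t : S) * j 1 = θ s * j 1 * (θ t * j 1)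
        rw [mul_assoc, hp, Submonoid.coe_mul, map_mul, mul_assoc]) }
  let m : Sᵐᵒᵖ →* he.Corner :=
    { toFun := fun s => ⟨j 1 * θ (s.unop : G)⁻¹, (Subsemigroup.mem_corner_iff he).mpr
        ⟨by rw [← mul_assoc, h1], hm _⟩⟩
      map_one' := Subtype.ext (by
        change j 1 * θ ((1 : S) : G)⁻¹ = j 1
        rw [Submonoid.coe_one, inv_one, map_one θ, mul_one])
      map_mul' := fun s t => Subtype.ext (by
        change j 1 * θ ((t.unop * s.unop : S) : G)⁻¹ =
          j 1 * θ (s.unop : G)⁻¹ * (j 1 * θ (t.unop : G)⁻¹)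
        rw [← mul_assoc, hm, Submonoid.coe_mul, mul_inv_rev, map_mul, mul_assoc]) }
  obtain ⟨g, ⟨hg, -⟩, -⟩ := existsUnique_lift α f p m (by
    refine ⟨fun s a => Subtype.ext ?_, fun s a => Subtype.ext ?_, fun s => Subtype.ext ?_,
      fun s => Subtype.ext ?_⟩
    · change θ s * j 1 * j a = j (α s a) * (θ s * j 1)
      rw [mul_assoc, h1, h, ← mul_assoc, ← h, mul_assoc, h2, h]
    · change j a * (j 1 * θ (s : G)⁻¹) = j 1 * θ (s : G)⁻¹ * j (α s a)
      rw [mul_assoc, ← hinv, ← mul_assoc, ← mul_assoc, h1, h2]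
    · change j 1 * θ (s : G)⁻¹ * (θ s * j 1) = j 1
      rw [mul_assoc, ← mul_assoc _ (θ s), hθ', one_mul, h1]
    · change θ s * j 1 * (j 1 * θ (s : G)⁻¹) = j (α s 1)
      rw [mul_assoc, ← mul_assoc (j 1), h1, ← mul_assoc, h, mul_assoc, hθ, mul_one])
  intro a b hab
  refine hj (congrArg Subtype.val (?_ : f a = f b))
  rw [← hg, ← hg, hab]

open Filter in
/-- The filter on `G` of the sets containing some translate `S h`; it is proper because
`G = S⁻¹ S` makes these translates directed. -/
def translateFilter (hG : ∀ g : G, ∃ s ∈ S, ∃ t ∈ S, g = s⁻¹ * t) : Filter G where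
  sets := {U | ∃ h : G, ∀ s ∈ S, s * h ∈ U}
  univ_sets := ⟨1, fun _ _ => trivial⟩
  sets_of_superset := fun ⟨h, hU⟩ hUV => ⟨h, fun s hs => hUV (hU s hs)⟩
  inter_sets := fun {U V} ⟨h, hU⟩ ⟨h', hV⟩ => by
    obtain ⟨x, hx, y, hy, hxy⟩ := hG (h * h'⁻¹)
    refine ⟨x * h, fun s hs => ⟨?_, ?_⟩⟩
    · rw [← mul_assoc]; exact hU _ (mul_mem hs hx)
    · have : x * h = y * h' := by
        calc x * h = x * (h * h'⁻¹) * h' := by group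
          _ = y * h' := by rw [hxy]; group
      rw [this, ← mul_assoc]; exact hV _ (mul_mem hs hy)

open Filter in
/-- The map `φ : A → Sᵒᵖ *_α A *_α S` is injective. The representing covariant pair lives on the
additive group of germs of functions `G → A` along the filter of translates of `S`: the group `G`
acts by translation and `a` acts as multiplication by the germ of `g ↦ α_g(a)`, which is defined
eventually, that is, on `S`. -/
theorem coeffHom_injective (hG : ∀ g : G, ∃ s ∈ S, ∃ t ∈ S, g = s⁻¹ * t)
    (hα : ∀ s, Function.Injective (α s)) : Function.Injective (coeffHom α) := by
  classical
  let l := translateFilter hG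
  have hl : l.NeBot := by
    refine ⟨fun h => ?_⟩
    obtain ⟨h, hh⟩ : (∅ : Set G) ∈ l := h ▸ mem_bot
    exact hh 1 (one_mem S)
  have hev : ∀ h : G, ∀ᶠ g in l, g * h ∈ S := fun h =>
    ⟨h⁻¹, fun s hs => by
      change s * h⁻¹ * h ∈ S
      rwa [inv_mul_cancel_right]⟩
  have htend : ∀ h : G, Tendsto (fun g => g * h) l l := fun h U ⟨k, hk⟩ =>
    ⟨k * h⁻¹, fun s hs => by
      change s * (k * h⁻¹) * h ∈ U
      rw [← mul_assoc, inv_mul_cancel_right]; exact hk s hs⟩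
  let F : A → G → A := fun a g => if h : g ∈ S then α ⟨g, h⟩ a else 0
  let ι : A →ₙ+* Germ l A :=
    { toFun := fun a => (F a : Germ l A)
      map_zero' := congrArg _ (funext fun g => by simp [F])
      map_add' := fun a b => congrArg (fun f : G → A => (f : Germ l A))
        (funext fun g => by by_cases h : g ∈ S <;> simp [F, h])
      map_mul' := fun a b => congrArg (fun f : G → A => (f : Germ l A))
        (funext fun g => by by_cases h : g ∈ S <;> simp [F, h]) }
  let θ : G →* AddMonoid.End (Germ l A) :=
    { toFun := fun h =>
        { toFun := fun f => f.compTendsto _ (htend h)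
          map_zero' := rfl
          map_add' := fun f f' => Germ.inductionOn₂ f f' fun _ _ => rfl }
      map_one' := AddMonoidHom.ext fun f => Germ.inductionOn f fun f =>
        congrArg (fun f : G → A => (f : Germ l A)) (funext fun g => congrArg f (mul_one g))
      map_mul' := fun h h' => AddMonoidHom.ext fun f => Germ.inductionOn f fun f =>
        congrArg (fun f : G → A => (f : Germ l A))
          (funext fun g => congrArg f (mul_assoc g h h').symm) }
  let j : A →ₙ+* AddMonoid.End (Germ l A) :=
    { toFun := fun a => AddMonoidHom.mulLeft (ι a)
      map_zero' := AddMonoidHom.ext fun x => by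
        change ι 0 * x = 0
        rw [map_zero, zero_mul]
      map_add' := fun a b => AddMonoidHom.ext fun x => by
        change ι (a + b) * x = ι a * x + ι b * x
        rw [map_add, add_mul]
      map_mul' := fun a b => AddMonoidHom.ext fun x => by
        change ι (a * b) * x = ι a * (ι b * x)
        rw [map_mul, mul_assoc] }
  refine coeffHom_injective_of_covariant j ?_ θ fun s a => ?_
  · rw [injective_iff_map_eq_zero]
    intro a ha
    have h1 : ι a * 1 = 0 := DFunLike.congr_fun ha 1
    rw [mul_one] at h1
    have h2 : ∀ᶠ g in l, F a g = 0 := Germ.coe_eq.mp h1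
    obtain ⟨g, hg0, hgS⟩ := (h2.and (hev 1)).exists
    rw [mul_one] at hgS
    simp only [F, dif_pos hgS] at hg0
    exact (map_eq_zero_iff _ (hα _)).mp hg0
  · refine AddMonoidHom.ext fun f => Germ.inductionOn f fun f => ?_
    refine Germ.coe_eq.mpr ?_
    filter_upwards [hev s, hev 1] with g hgs hg
    rw [mul_one] at hg
    change F a (g * s) * f (g * s) = F (α s a) g * f (g * s)
    congr 1
    simp only [F, dif_pos hgs, dif_pos hg]
    have : (⟨g * s, hgs⟩ : S) = ⟨g, hg⟩ * s := rfl
    rw [this, map_mul]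
    rfl

end Embedding

end FracSkewMonoidRing

/-! ### Compressing an element into the coefficient ring -/

namespace FracSkewMonoidRing

variable {G : Type*} [Group G] {S : Submonoid G} {A : Type*} [Ring A] {α : S →* (A →ₙ+* A)}

theorem monomial_injective (hφ : Function.Injective (coeffHom α)) {s t : S} {a b : A}
    (h : monomial α s a t = monomial α s b t) : α s 1 * a * α t 1 = α s 1 * b * α t 1 :=
  hφ (by rw [← plusHom_mul_monomial_mul_minusHom, h, plusHom_mul_monomial_mul_minusHom])

/-- If every nonzero `a ∈ A` can be multiplied by `s₋ φ(b)` and `φ(c) s₊` into an infinite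
idempotent `φ(f + g)`, with `f, g` nonzero orthogonal idempotents of `A`, and `α` is outer, then
every nonzero element of `R` can be multiplied into such an idempotent.

Among the nonzero elements `y x z`, one with the least number of homogeneous components can be
normalised to have component `φ(e)` in degree `1`, where `e = f + g`, and to satisfy
`w = φ(e) w φ(e)`. For `b, c ∈ e A e` with `b c = 0` the element `φ(b) w φ(c)` has no component in
degree `1`, hence vanishes by minimality. So a component of `w` in another degree would make some
pair `(α_s, α_t)` inner. -/
theorem exists_mul_mul_eq_coeffHom [IsSimpleRing A]
    (hG : ∀ g : G, ∃ s ∈ S, ∃ t ∈ S, g = s⁻¹ * t) (hα : ActsByCornerIsos α)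
    (houter : IsOuterAction α)
    (h : ∀ a : A, a ≠ 0 → ∃ (s : S) (b c f g : A), IsIdempotentElem f ∧ IsIdempotentElem g ∧
      f * g = 0 ∧ g * f = 0 ∧ f ≠ 0 ∧ g ≠ 0 ∧ IsInfiniteIdem (coeffHom α (f + g)) ∧
      monomial α s (b * a * c) s = coeffHom α (f + g))
    {x : FracSkewMonoidRing α} (hx : x ≠ 0) :
    ∃ (y z : FracSkewMonoidRing α) (e : A), e ≠ 0 ∧ y * x * z = coeffHom α e ∧
      IsInfiniteIdem (coeffHom α e) := by
  classical
  have hφ : Function.Injective (coeffHom α) := coeffHom_injective hG fun s => (hα s).1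
  have hex : ∃ n, ∃ w, w ≠ 0 ∧ (∃ y z, w = y * x * z) ∧ (degrees α w).card = n :=
    ⟨_, x, hx, ⟨1, 1, by simp⟩, rfl⟩
  have hmin : ∀ w, w ≠ 0 → (∃ y z, w = y * x * z) → Nat.find hex ≤ (degrees α w).card :=
    fun w hw hw' => Nat.find_min' hex ⟨w, hw, hw', rfl⟩
  obtain ⟨w₁, hw₁, ⟨y₁, z₁, hyz₁⟩, hcard₁⟩ := Nat.find_spec hex
  -- move a nonzero component to degree `1`
  obtain ⟨k, hk⟩ := degrees_nonempty α hG hw₁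
  obtain ⟨s, t, a', hst, hka⟩ := exists_component_eq_monomial α hG k w₁
  have ha : α s 1 * a' * α t 1 ≠ 0 := fun h0 => (mem_degrees α).mp hk (by
    rw [hka, monomial_eq_corner, h0]; simp [monomial])
  have hw₂ : component α 1 (plusHom α s * w₁ * minusHom α (.op t)) =
      coeffHom α (α s 1 * a' * α t 1) := by
    rw [component_mul_mul (grading_plusHom α s) (grading_minusHom α t), inv_inv, one_mul, ← hst,
      hka, plusHom_mul_monomial_mul_minusHom]
  have hcard₂ := card_degrees_mul_mul_le (grading_plusHom α s) (grading_minusHom α t) w₁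
  obtain ⟨w₂, hw₂def⟩ : ∃ w₂, w₂ = plusHom α s * w₁ * minusHom α (.op t) := ⟨_, rfl⟩
  rw [← hw₂def] at hw₂ hcard₂
  -- turn the component in degree `1` into an infinite idempotent
  obtain ⟨r, b, c, f, g, hf, hg, hfg, hgf, hf0, hg0, hinf, hr⟩ := h _ ha
  have hgrb : grading α (minusHom α (.op r) * coeffHom α b) =
      MonoidAlgebra.single (r : G)⁻¹ (minusHom α (.op r) * coeffHom α b) := by
    rw [map_mul, grading_minusHom, grading_coeffHom, MonoidAlgebra.single_mul_single, mul_one]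
  have hgrc : grading α (coeffHom α c * plusHom α r) =
      MonoidAlgebra.single (r : G) (coeffHom α c * plusHom α r) := by
    rw [map_mul, grading_plusHom, grading_coeffHom, MonoidAlgebra.single_mul_single, one_mul]
  have hcard₃ := card_degrees_mul_mul_le hgrb hgrc w₂
  have hw₃ : component α 1 (minusHom α (.op r) * coeffHom α b * w₂ *
      (coeffHom α c * plusHom α r)) = coeffHom α (f + g) := by
    rw [component_mul_mul hgrb hgrc, one_mul, inv_inv, mul_inv_cancel, hw₂, ← hr, monomial]
    simp only [map_mul, mul_assoc]
  obtain ⟨w₃, hw₃def⟩ : ∃ w₃, w₃ = minusHom α (.op r) * coeffHom α b * w₂ *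
      (coeffHom α c * plusHom α r) := ⟨_, rfl⟩
  rw [← hw₃def] at hw₃ hcard₃
  have he : IsIdempotentElem (f + g) := by
    rw [IsIdempotentElem, add_mul, mul_add, mul_add, hf.eq, hg.eq, hfg, hgf, add_zero, zero_add]
  have he0 : f + g ≠ 0 := fun h0 => hf0 (by
    have : (f + g) * f = f := by rw [add_mul, hf.eq, hgf, add_zero]
    rw [← this, h0, zero_mul])
  -- compress by the idempotent
  have hcard₄ := card_degrees_mul_mul_le (grading_coeffHom α (f + g))
    (grading_coeffHom α (f + g)) w₃
  have hw₄ : component α 1 (coeffHom α (f + g) * w₃ * coeffHom α (f + g)) =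
      coeffHom α (f + g) := by
    rw [component_coeffHom_mul_mul, hw₃, ← map_mul, ← map_mul, he.eq, he.eq]
  have hcomp : coeffHom α (f + g) * (coeffHom α (f + g) * w₃ * coeffHom α (f + g)) *
      coeffHom α (f + g) = coeffHom α (f + g) * w₃ * coeffHom α (f + g) := by
    have he' : coeffHom α (f + g) * coeffHom α (f + g) = coeffHom α (f + g) := by
      rw [← map_mul, he.eq]
    rw [← mul_assoc, ← mul_assoc, he', mul_assoc _ (coeffHom α (f + g)) (coeffHom α (f + g)), he']
  obtain ⟨w, hwdef⟩ : ∃ w, w = coeffHom α (f + g) * w₃ * coeffHom α (f + g) := ⟨_, rfl⟩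
  rw [← hwdef] at hw₄ hcard₄ hcomp
  have hT : ∃ y z, w = y * x * z :=
    ⟨coeffHom α (f + g) * (minusHom α (.op r) * coeffHom α b * (plusHom α s * y₁)),
      z₁ * minusHom α (.op t) * (coeffHom α c * plusHom α r) * coeffHom α (f + g), by
        rw [hwdef, hw₃def, hw₂def, hyz₁]; simp only [mul_assoc]⟩
  have hcard : (degrees α w).card ≤ Nat.find hex :=
    hcard₄.trans (hcard₃.trans (hcard₂.trans hcard₁.le))
  have h1mem : (1 : G) ∈ degrees α w := by
    rw [mem_degrees, hw₄]
    exact (map_ne_zero_iff _ hφ).mpr he0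
  have hvanish : ∀ b c : A, (f + g) * b * (f + g) = b → b * c = 0 →
      coeffHom α b * w * coeffHom α c = 0 := by
    intro b c hb hbc
    by_contra hne
    have hbe : b * (f + g) = b := by rw [← hb, mul_assoc, he.eq]
    have hlt := card_degrees_coeffHom_mul_mul_lt (b := b) (c := c) h1mem (by
      rw [hw₄, ← map_mul, ← map_mul, hbe, hbc, map_zero])
    obtain ⟨y, z, hyz⟩ := hT
    have := hmin _ hne ⟨coeffHom α b * y, z * coeffHom α c, by
      rw [hyz]; simp only [mul_assoc]⟩
    omega
  have hdeg : degrees α w = {1} := by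
    refine Finset.eq_singleton_iff_unique_mem.mpr ⟨h1mem, fun k hk => ?_⟩
    by_contra hk1
    obtain ⟨s, t, a', hst, hka⟩ := exists_component_eq_monomial α hG k w
    rw [monomial_eq_corner] at hka
    obtain ⟨a, hadef⟩ : ∃ a, a = α s 1 * a' * α t 1 := ⟨_, rfl⟩
    rw [← hadef] at hka
    have hstne : s ≠ t := fun hst' => hk1 (by rw [hst, hst', inv_mul_cancel])
    have hss : ∀ b, α s 1 * α s b = α s b := fun b => by rw [← map_mul, one_mul]
    have htt : ∀ b, α t b * α t 1 = α t b := fun b => by rw [← map_mul, mul_one]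
    have hcorner : ∀ b c, α s 1 * (α s b * a * α t c) * α t 1 = α s b * a * α t c := by
      intro b c
      rw [mul_assoc, mul_assoc (α s b * a), htt, ← mul_assoc, ← mul_assoc, hss]
    have hacorner : α s 1 * a * α t 1 = a := by
      have h1 := hss 1
      have h2 := htt 1
      rw [hadef, mul_assoc, mul_assoc (α s 1 * a'), h2, ← mul_assoc, ← mul_assoc, h1]
    have hact : ∀ b c, coeffHom α b * component α k w * coeffHom α c =
        monomial α s (α s b * a * α t c) t := by
      intro b c
      rw [hka, coeffHom_mul_monomial, monomial_mul_coeffHom]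
    refine houter s t hstne (isInnerPair_of_forall_mul_eq_zero hα (a := a) hf hg hfg hgf hf0 hg0
      ?_ ?_ ?_)
    · intro h0
      rw [h0] at hka
      exact (mem_degrees α).mp hk (by rw [hka]; simp [monomial])
    · rw [← hcorner]
      conv_rhs => rw [← hacorner]
      apply monomial_injective hφ
      rw [← hact, ← component_coeffHom_mul_mul, hcomp, hka]
    · intro b c hb _ hbc
      rw [← hcorner]
      have h0 : monomial α s (α s b * a * α t c) t = monomial α s 0 t := by
        rw [← hact, ← component_coeffHom_mul_mul, hvanish b c hb hbc, component_zero]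
        simp [monomial]
      rw [monomial_injective hφ h0, mul_zero, zero_mul]
  obtain ⟨y, z, hyz⟩ := hT
  refine ⟨y, z, f + g, he0, ?_, hinf⟩
  rw [← hyz, ← sum_component α hG w, hdeg, Finset.sum_singleton, hw₄]

end FracSkewMonoidRing

/-! ### Infinite idempotents from the coefficient ring -/

open FracSkewMonoidRing

theorem FracSkewMonoidRing.isInfiniteIdem_one {A S : Type*} [Ring A] [Monoid S]
    {α : S →* (A →ₙ+* A)} (hφ : Function.Injective (coeffHom α)) {u : S} (hu : α u 1 ≠ 1) :
    IsInfiniteIdem (1 : FracSkewMonoidRing α) := by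
  have hp : IsIdempotentElem (coeffHom α (α u 1)) := by
    rw [IsIdempotentElem, ← map_mul, ← map_mul, one_mul]
  refine ⟨IsIdempotentElem.one, coeffHom α (α u 1), 1 - coeffHom α (α u 1), hp, hp.one_sub, ?_, ?_,
    ?_, ?_, minusHom α (.op u), plusHom α u, ?_, ?_, ?_, ?_⟩
  · rw [mul_sub, mul_one, hp.eq, sub_self]
  · rw [sub_mul, one_mul, hp.eq, sub_self]
  · rw [add_sub_cancel]
  · rw [sub_ne_zero, ← map_one (coeffHom α)]
    exact fun h => hu (hφ h).symm
  · rw [one_mul, ← coeffHom_mul_minusHom, map_one, one_mul]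
  · rw [mul_one, ← plusHom_mul_coeffHom, map_one, mul_one]
  · exact minusHom_mul_plusHom α u
  · exact plusHom_mul_minusHom α u

theorem IsPurelyInfiniteSimple.exists_mul_eq {A : Type*} [Ring A] (hA : IsPurelyInfiniteSimple A)
    {a : A} (ha : a ≠ 0) : ∃ c f g : A, IsIdempotentElem f ∧ IsIdempotentElem g ∧ f * g = 0 ∧
      g * f = 0 ∧ f ≠ 0 ∧ g ≠ 0 ∧ IsInfiniteIdem (f + g) ∧ a * c = f + g := by
  obtain ⟨e, heI, he⟩ := hA.2 (Submodule.span Aᵐᵒᵖ {a})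
    (by rwa [Ne, Submodule.span_singleton_eq_bot])
  obtain ⟨c, hc⟩ := Submodule.mem_span_singleton.mp heI
  obtain ⟨-, f, g, hf, hg, hfg, hgf, hsum, hg0, x, y, hx, -, hxy, -⟩ := id he
  rw [hsum] at hc he
  refine ⟨c.unop, f, g, hf, hg, hfg, hgf, ?_, hg0, he, hc⟩
  rintro rfl
  rw [mul_zero] at hx
  rw [← hx, zero_mul, hsum, zero_add] at hxy
  exact hg0 hxy.symm

theorem iterate_one_eq_pow_one {A S : Type*} [Ring A] [Monoid S] (α : S →* (A →ₙ+* A)) (u : S)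
    (n : ℕ) : (α u)^[n] 1 = α (u ^ n) 1 := by
  induction n with
  | zero => rw [pow_zero, map_one α]; rfl
  | succ n ih => rw [Function.iterate_succ_apply', ih, pow_succ', map_mul]; rfl

theorem corollary5p4 {G : Type*} [Group G] (S : Submonoid G)
    (hG : ∀ g : G, ∃ s ∈ S, ∃ t ∈ S, g = s⁻¹ * t)
    {A : Type*} [Ring A] (α : S →* (A →ₙ+* A))
    (hcorner : ActsByCornerIsos α)
    (hA : IsPurelyInfiniteSimple A ∨
      (IsSimpleRing A ∧
        ∃ (k : Type*) (_ : Field k) (_ : Algebra k A), IsUltramatricial k A))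
    (houter : IsOuterAction α)
    (hu : ∃ u : S, actionIdem α u ≠ 1) :
    IsPurelyInfiniteSimple (FracSkewMonoidRing α) := by
  have hsimple : IsSimpleRing A := hA.elim (fun h => h.1) (fun h => h.1)
  have hφ : Function.Injective (coeffHom α) := coeffHom_injective hG fun s => (hcorner s).1
  have : Nontrivial (FracSkewMonoidRing α) := hφ.nontrivial
  have hcompress : ∀ a : A, a ≠ 0 → ∃ (s : S) (b c f g : A), IsIdempotentElem f ∧
      IsIdempotentElem g ∧ f * g = 0 ∧ g * f = 0 ∧ f ≠ 0 ∧ g ≠ 0 ∧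
      IsInfiniteIdem (coeffHom α (f + g)) ∧
      monomial α s (b * a * c) s = coeffHom α (f + g) := by
    intro a ha
    rcases hA with hA | ⟨-, k, _, _, hA⟩
    · obtain ⟨c, f, g, hf, hg, hfg, hgf, hf0, hg0, hinf, hac⟩ := hA.exists_mul_eq ha
      exact ⟨1, 1, c, f, g, hf, hg, hfg, hgf, hf0, hg0, hinf.map _ hφ, by
        rw [one_mul, hac]; simp [monomial]⟩
    · obtain ⟨u, hu⟩ := hu
      have hp : IsIdempotentElem (α u 1) := by rw [IsIdempotentElem, ← map_mul, one_mul]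
      obtain ⟨n, b, c, hbc⟩ := hA.exists_iterate_eq_mul_mul (α u) hu ha
      refine ⟨u ^ n, b, c, α u 1, 1 - α u 1, hp, hp.one_sub, ?_, ?_, ?_, ?_, ?_, ?_⟩
      · rw [mul_sub, mul_one, hp.eq, sub_self]
      · rw [sub_mul, one_mul, hp.eq, sub_self]
      · exact (map_ne_zero_iff _ (hcorner u).1).mpr one_ne_zero
      · exact sub_ne_zero.mpr hu.symm
      · rw [add_sub_cancel, map_one]
        exact isInfiniteIdem_one hφ hu
      -- `(uⁿ)₋ φ(α_{uⁿ}(1)) (uⁿ)₊ = 1`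
      · rw [← hbc, iterate_one_eq_pow_one, add_sub_cancel]
        have h1 := monomial_eq_mul_left α (u ^ n) 1 1 1
        rw [mul_one] at h1
        rw [← h1]
        simp [monomial]
  refine isPurelyInfiniteSimple_of_forall_exists fun x hx => ?_
  obtain ⟨y, z, e, he0, hyz, hinf⟩ :=
    exists_mul_mul_eq_coeffHom hG hcorner houter hcompress hx
  refine ⟨y, z, by rwa [hyz], fun I hI => ?_⟩
  obtain ⟨n, b, c, hbc⟩ := IsSimpleRing.exists_sum_mul_mul_eq_one he0
  rw [← map_one (coeffHom α), ← hbc, map_sum]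
  refine sum_mem fun i _ => ?_
  rw [map_mul, map_mul, ← hyz]
  exact I.mul_mem_right _ _ (I.mul_mem_left _ _ hI)
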